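/- Let $L=\mathcal O(1)\to\mathbf{CP}^1$ and let $h_t$, $t\in[0,1]$, be a path, $C^\infty$ on $[0,1]\times\mathbf{CP}^1$, of $S^1$-invariant Hermitian metrics on $L$ with positive curvature form $\omega_t=\mathrm{Ric}(h_t)>0$, which is a geodesic: writing $h_t=h_0e^{-\varphi_t}$, $\partial_t^2\varphi_t=|\partial\,\partial_t\varphi_t|^2_{\omega_t}$. In the affine coordinate $z$ write $\omega_t=\sqrt{-1}\,\partial\bar\partial u_t$, where $u_t=-\log|Z_0|^2_{h_t}$ and $Z_0$ is the section of $L$ corresponding to the monomial $1$. Put $U_t(\rho)=u_t(z)$ with $\rho=\log|z|^2$; let $G_t$ be the symplectic potential, i.e. the Legendre transform $G_t(x)=x\rho-U_t(\rho)$, $x=U_t'(\rho)\in(0,1)$; and let $f_t=G_t-G_P$ with $G_P(x)=x\log x+(1-x)\log(1-x)$. For integers $N\ge1$ and real $\alpha\in(0,1)$ define the norming constants $$\mathcal Q_t^N(\alpha)=\int_{\mathbf{CP}^1}|z^{N\alpha}|^2_{h_t^N}\,\omega_t=\int_{\mathbf C}|z|^{2N\alpha}e^{-Nu_t}\,\omega_t,\qquad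 Q_t^N(\alpha)=\mathcal Q_t^N(\alpha)\,e^{-NG_t(\alpha)}.$$ **Proposition 3.1.** Let $M=N\alpha$. Then there are functions $A_{t,k}(\alpha)$, $k\ge0$, of $t\in[0,1]$ and $\alpha\in(0,\tfrac23]$ (independent of $N$), each $A_{t,k}$ being bounded uniformly in $(t,\alpha)$, with $A_{t,0}=1$, such that for $\alpha\in[N^{-3/4},\tfrac23]$ $$Q_t^N(\alpha)\sim\frac{(2\pi)^{3/2}\,\alpha}{\left(\frac1{1-\alpha}+\alpha f_t''(\alpha)\right)^{1/2}M^{1/2}}\sum_{k=0}^\infty\frac{A_{t,k}(\alpha)}{M^k}=\frac{(2\pi)^{3/2}}{(G_t''(\alpha))^{1/2}N^{1/2}}\sum_{k=0}^\infty\frac{A_{t,k}(\alpha)}{M^k},$$ in the following sense: the integral $\mathcal Q_t^N(\alpha)$ converges, $G_t$ is smooth at $\alpha$ with $G_t''(\alpha)>0$, $\frac1{1-\alpha}+\alpha f_t''(\alpha)>0$, the two forms of the leading factor agree, and for every integer $R\ge0$ there is $C_R>0$, depending only on $R$ and the path $(h_t)$, such that for all $t\in[0,1]$, all integers $N\ge1$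 and all $\alpha\in[N^{-3/4},\tfrac23]$ $$\left|Q_t^N(\alpha)-\frac{(2\pi)^{3/2}\,\alpha}{\left(\frac1{1-\alpha}+\alpha f_t''(\alpha)\right)^{1/2}M^{1/2}}\sum_{k=0}^R\frac{A_{t,k}(\alpha)}{M^k}\right|\le\frac{C_R\,\alpha}{\left(\frac1{1-\alpha}+\alpha f_t''(\alpha)\right)^{1/2}M^{1/2}}\,M^{-(R+1)}.$$ -/

import Mathlib

open Set MeasureTheory
open scoped ContDiff Laplacian Gradient

noncomputable section

/-!
Toric Kähler geometry of the hyperplane bundle `L = O(1)` over `CP¹`.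

A smooth Hermitian metric `h` on `L` is encoded by the squared norm
`H : ℂ² → ℝ` of the dual metric on the tautological bundle `O(-1)`. Thus `H` is positive and
smooth off the origin, `H (c v) = |c|² H v`, and for a section `s` of `L ^ N`, viewed as a
homogeneous function of degree `N` on `ℂ² \ {0}`, one has `|s|²_{h^N} ([v]) = |s v|² / (H v) ^ N`.
-/

/-- The local Kähler potential `u(z) = log H(1, z)` on the affine chart `[1 : z]`
(that is, `-log |Z₀|²_h`, where `Z₀` is the frame of `L` on that chart). -/
def kahlerPotential (H : ℂ × ℂ → ℝ) (z : ℂ) : ℝ := Real.log (H (1, z))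

/-- The local Kähler potential `log H(w, 1)` on the affine chart `[w : 1]` at infinity. -/
def kahlerPotentialInfty (H : ℂ × ℂ → ℝ) (w : ℂ) : ℝ := Real.log (H (w, 1))

/-- The density, with respect to Lebesgue measure `dx dy` on the chart `[1 : x + iy]`, of the form
`ω = Ric(h) = √-1 ∂∂̄u = √-1 u_{z z̄} dz ∧ dz̄ = 2 u_{z z̄} dx ∧ dy = (1/2) (Δ u) dx ∧ dy`. -/
def kahlerDensity (H : ℂ × ℂ → ℝ) (z : ℂ) : ℝ := (1 / 2) * Δ (kahlerPotential H) z

/-- `H` is (dual to) a smooth Hermitian metric on `O(1) → CP¹` which is invariant under the circle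
action `[z₀ : z₁] ↦ [z₀ : c z₁]` and has positive curvature. -/
structure IsToricPositiveMetric (H : ℂ × ℂ → ℝ) : Prop where
  pos : ∀ v, v ≠ 0 → 0 < H v
  homogeneous : ∀ (c : ℂ) (v : ℂ × ℂ), H (c • v) = ‖c‖ ^ 2 * H v
  smooth : ContDiffOn ℝ ∞ H {0}ᶜ
  invariant : ∀ (c : ℂ) (v : ℂ × ℂ), ‖c‖ = 1 → H (v.1, c * v.2) = H v
  curvature_pos : ∀ z, 0 < Δ (kahlerPotential H) z
  curvature_pos_infty : ∀ w, 0 < Δ (kahlerPotentialInfty H) w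

/-- A path `h_t`, `t ∈ [0, 1]`, of toric positively curved metrics, smooth in all variables, that
is a geodesic: `∂²φ/∂t² = |∂ (∂φ/∂t)|²_{ω_t}`, where `h_t = h_0 e^{-φ_t}`.
As `φ_t = log (H_t / H_0)`, its `t`-derivatives are those of the local potentials of `h_t`. In a
chart, `|∂ψ|²_ω = |ψ_z|² / u_{z z̄} = |∇ψ|² / Δu`. The equation is written in both charts and on
the open time interval; it extends to `t = 0, 1` by continuity. -/
structure IsToricGeodesic (H : ℝ → ℂ × ℂ → ℝ) : Prop where
  metric : ∀ t ∈ Icc (0 : ℝ) 1, IsToricPositiveMetric (H t)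
  smooth : ContDiffOn ℝ ∞ (fun p : ℝ × (ℂ × ℂ) => H p.1 p.2) (Icc (0 : ℝ) 1 ×ˢ {0}ᶜ)
  geodesic : ∀ t ∈ Ioo (0 : ℝ) 1, ∀ z : ℂ,
    iteratedDeriv 2 (fun s => kahlerPotential (H s) z) t =
      ‖∇ (fun y => deriv (fun s => kahlerPotential (H s) y) t) z‖ ^ 2 /
        Δ (kahlerPotential (H t)) z
  geodesic_infty : ∀ t ∈ Ioo (0 : ℝ) 1, ∀ w : ℂ,
    iteratedDeriv 2 (fun s => kahlerPotentialInfty (H s) w) t =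
      ‖∇ (fun y => deriv (fun s => kahlerPotentialInfty (H s) y) t) w‖ ^ 2 /
        Δ (kahlerPotentialInfty (H t)) w

/-- The potential in the logarithmic coordinate `ρ = log |z|²`: `U(ρ) = u(e^{ρ/2})`. -/
def logPotential (H : ℂ × ℂ → ℝ) (ρ : ℝ) : ℝ :=
  kahlerPotential H (Real.exp (ρ / 2) : ℝ)

/-- The symplectic potential: the Legendre transform `G(x) = sup_ρ (x ρ - U(ρ))` of `U`. Since `U`
is convex, the supremum for `x ∈ (0, 1)` is attained at the `ρ` with `U'(ρ) = x`, so that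
`G(x) = x ρ - U(ρ)` with `x = U'(ρ)`. -/
def symplecticPotential (H : ℂ × ℂ → ℝ) (x : ℝ) : ℝ := ⨆ ρ : ℝ, (x * ρ - logPotential H ρ)

/-- The reference symplectic potential `G_P(x) = x log x + (1 - x) log (1 - x)` of `P = [0, 1]`. -/
def referencePotential (x : ℝ) : ℝ := x * Real.log x + (1 - x) * Real.log (1 - x)

/-- The function `f = G - G_P`. -/
def potentialDifference (H : ℂ × ℂ → ℝ) (x : ℝ) : ℝ :=
  symplecticPotential H x - referencePotential x

/-- The pointwise squared norm `|z^{Nα}|²_{h^N} = |z|^{2Nα} e^{-N u(z)}` at `[1 : z]`, for real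
`α ∈ [0, 1]`. -/
def monomialNormSq (H : ℂ × ℂ → ℝ) (N : ℕ) (α : ℝ) (z : ℂ) : ℝ :=
  ‖z‖ ^ (2 * ((N : ℝ) * α)) / (H (1, z)) ^ N

/-- The `L²` norming constant `𝒬^N(α) = ∫_X |z^{Nα}|²_{h^N} ω`. The point at infinity of
`X = CP¹` carries no mass, so the integral is taken over the affine chart. -/
def monomialL2NormSq (H : ℂ × ℂ → ℝ) (N : ℕ) (α : ℝ) : ℝ :=
  ∫ z : ℂ, monomialNormSq H N α z * kahlerDensity H z

/-- The normalized norming constant `Q^N(α) = 𝒬^N(α) e^{-N G(α)}`. -/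
def normingConstant (H : ℂ × ℂ → ℝ) (N : ℕ) (α : ℝ) : ℝ :=
  monomialL2NormSq H N α * Real.exp (-(N * symplecticPotential H α))

/-- The factor `α / ((1 / (1 - α) + α f''(α))^{1/2} M^{1/2})` with `M = Nα`. -/
def leadingScale (H : ℂ × ℂ → ℝ) (N : ℕ) (α : ℝ) : ℝ :=
  α / (Real.sqrt (1 / (1 - α) + α * iteratedDeriv 2 (potentialDifference H) α) *
    Real.sqrt (N * α))

end

/-! In the coordinate ρ = log |z|² the norming integral becomes 2π ∫ exp(N(αρ - U(ρ))) U''(ρ) dρ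
(`monomialL2NormSq_eq`). Since U is strictly convex, the exponent peaks exactly at the ρ with U'(ρ)
= α, with value N G(α), and Laplace's method gives the expansion. The difficulty is uniformity as α
→ 0, where ρ → -∞ and U'' degenerates.

The cure is to divide the exponent by α. With φ(σ) = (U(ρ+σ) - U(ρ))/α - σ one gets Q = 2πα ∫
exp(-Mφ) φ'' dσ (`normingConstant_eq`), so M = Nα is the large parameter. U is a smooth even
function of r = exp(ρ/2), hence all its derivatives of order ≥ 1 are O(e^ρ) as ρ → -∞. Positive
curvature gives U'' ≥ c e^ρ and, by integration, U' ≥ c e^ρ. The condition α ≤ 2/3 bounds ρ above.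
So on [-1, 1] the phases have bounded derivatives and φ'' ≥ c > 0, uniformly in t and α
(`exists_phase_bounds`), and `exists_uniform_laplace_expansion` applies there. Its leading term
contains φ''(0) = U''(ρ)/α = 1/(α G''(α)).

Outside [-1, 1], convexity gives φ ≥ c/2, and φ'' has total mass 1/α, so this part contributes at
most 2π exp(-cM/2) to Q. The allowed error carries a factor α. The bound α ≥ N^(-3/4), in the form α
M³ ≥ 1, supplies it at the cost of three powers of M. -/

/-! ### Taylor expansions uniform in a parameter -/

/-- The family `f p`, `p : P`, has at `0` the Taylor expansions `∑ e j p * x ^ j`, with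
coefficients and remainders bounded uniformly in `p`. -/
def HasUniformJet {P : Type*} (f : P → ℝ → ℝ) (e : ℕ → P → ℝ) : Prop :=
  (∀ j, ∃ B, ∀ p, |e j p| ≤ B) ∧
    ∀ J : ℕ, ∃ C, ∀ p, ∀ x ∈ Icc (-1 : ℝ) 1, x ≠ 0 →
      |f p x - ∑ j ∈ Finset.range J, e j p * x ^ j| ≤ C * |x| ^ J

theorem taylorWithinEval_uIcc_zero {f : ℝ → ℝ} (hf : ContDiff ℝ ∞ f) {x : ℝ} (hx : x ≠ 0) (n : ℕ) :
    taylorWithinEval f n (uIcc 0 x) 0 x =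
      ∑ k ∈ Finset.range (n + 1), iteratedDeriv k f 0 / k.factorial * x ^ k := by
  rw [taylor_within_apply]
  refine Finset.sum_congr rfl fun k _ => ?_
  rw [iteratedDerivWithin_eq_iteratedDeriv (uniqueDiffOn_uIcc hx.symm)
    (hf.contDiffAt.of_le (by exact_mod_cast le_top)) left_mem_uIcc]
  simp only [sub_zero, smul_eq_mul]
  ring

theorem exists_taylor_remainder {f : ℝ → ℝ} (hf : ContDiff ℝ ∞ f) {x : ℝ} (hx : x ≠ 0) (n : ℕ) :
    ∃ y ∈ uIcc 0 x, f x - ∑ k ∈ Finset.range n, iteratedDeriv k f 0 / k.factorial * x ^ k =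
      iteratedDeriv n f y * x ^ n / n.factorial := by
  rcases n with _ | n
  · exact ⟨x, right_mem_uIcc, by simp⟩
  · obtain ⟨y, hy, h⟩ := taylor_mean_remainder_lagrange_iteratedDeriv (n := n) hx.symm
      (hf.contDiffOn.of_le (by exact_mod_cast le_top))
    refine ⟨y, Ioo_subset_Icc_self hy, ?_⟩
    rw [taylorWithinEval_uIcc_zero hf hx] at h
    rw [h, sub_zero]

/-- Lagrange's remainder, with `max 1 (exp x)` rather than `exp |x|`: for x = -M x³h, multiplication
by the Gaussian turns the second branch back into exp(-Mφ), which the lower bound on φ controls. -/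
theorem abs_exp_sub_sum_le (x : ℝ) (n : ℕ) :
    |Real.exp x - ∑ k ∈ Finset.range n, x ^ k / k.factorial| ≤ |x| ^ n * max 1 (Real.exp x) := by
  rcases eq_or_ne x 0 with rfl | hx
  · rcases n with _ | n
    · simp
    · simp [Finset.sum_range_succ']
  obtain ⟨y, hy, h⟩ := exists_taylor_remainder Real.contDiff_exp hx n
  have hd (k : ℕ) : iteratedDeriv k Real.exp = Real.exp := by
    rw [iteratedDeriv_eq_iterate, Real.iter_deriv_exp]
  simp only [hd, Real.exp_zero] at h
  have h' : Real.exp x - ∑ k ∈ Finset.range n, x ^ k / k.factorial =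
      Real.exp y * x ^ n / n.factorial := by
    rw [← h]; congr 1; exact Finset.sum_congr rfl fun k _ => by ring
  have hy' : Real.exp y ≤ max 1 (Real.exp x) := by
    rcases le_total 0 x with h0 | h0
    · rw [uIcc_of_le h0] at hy
      exact le_max_of_le_right (Real.exp_le_exp.2 hy.2)
    · rw [uIcc_of_ge h0] at hy
      exact le_max_of_le_left (Real.exp_le_one_iff.2 hy.2)
  rw [h', abs_div, abs_mul, abs_pow, Real.abs_exp, Nat.abs_cast, mul_comm]
  refine (div_le_self (by positivity) ?_).trans (by gcongr)
  exact_mod_cast Nat.one_le_iff_ne_zero.2 (Nat.factorial_ne_zero n)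

namespace HasUniformJet

variable {P : Type*} {f g : P → ℝ → ℝ} {e d : ℕ → P → ℝ}

theorem of_iteratedDeriv_bound (hf : ∀ p, ContDiff ℝ ∞ (f p))
    (hB : ∀ n, ∃ B, ∀ p, ∀ x ∈ Icc (-1 : ℝ) 1, |iteratedDeriv n (f p) x| ≤ B) :
    HasUniformJet f (fun j p => iteratedDeriv j (f p) 0 / j.factorial) := by
  have h1 (n : ℕ) : (1 : ℝ) ≤ n.factorial := by
    exact_mod_cast Nat.one_le_iff_ne_zero.2 (Nat.factorial_ne_zero n)
  refine ⟨fun j => ?_, fun J => ?_⟩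
  · obtain ⟨B, hB⟩ := hB j
    refine ⟨B, fun p => ?_⟩
    rw [abs_div, Nat.abs_cast]
    exact (div_le_self (abs_nonneg _) (h1 j)).trans (hB p 0 (by norm_num))
  · obtain ⟨B, hB⟩ := hB J
    refine ⟨B, fun p x hx hx0 => ?_⟩
    obtain ⟨y, hy, h⟩ := exists_taylor_remainder (hf p) hx0 J
    rw [h, abs_div, abs_mul, abs_pow, Nat.abs_cast]
    have hy1 : y ∈ Icc (-1 : ℝ) 1 :=
      (uIcc_subset_Icc (by norm_num) hx : uIcc 0 x ⊆ Icc (-1) 1) hy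
    exact (div_le_self (by positivity) (h1 J)).trans (by gcongr; exact hB p y hy1)

/-- This division by a power of x is why the remainder estimates in `HasUniformJet` leave out x = 0.
-/
theorem shift (hf : HasUniformJet f e) (r : ℕ) :
    HasUniformJet (fun p x => (f p x - ∑ j ∈ Finset.range r, e j p * x ^ j) / x ^ r)
      (fun j => e (j + r)) := by
  refine ⟨fun j => hf.1 (j + r), fun J => ?_⟩
  obtain ⟨C, hC⟩ := hf.2 (r + J)
  refine ⟨C, fun p x hx hx0 => ?_⟩
  have h := hC p x hx hx0
  have hs : 0 < |x| ^ r := by positivity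
  rw [Finset.sum_range_add] at h
  have : (f p x - ∑ j ∈ Finset.range r, e j p * x ^ j) / x ^ r -
      ∑ j ∈ Finset.range J, e (j + r) p * x ^ j =
      (f p x - (∑ j ∈ Finset.range r, e j p * x ^ j +
        ∑ j ∈ Finset.range J, e (r + j) p * x ^ (r + j))) / x ^ r := by
    rw [eq_div_iff (by positivity), sub_mul, div_mul_cancel₀ _ (by positivity), ← sub_sub,
      Finset.sum_mul]
    congr 1
    exact Finset.sum_congr rfl fun j _ => by rw [add_comm j r]; ring
  rw [this, abs_div, abs_pow, div_le_iff₀ hs]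
  exact h.trans_eq (by ring)

theorem mul (hf : HasUniformJet f e) (hg : HasUniformJet g d) :
    HasUniformJet (fun p x => f p x * g p x)
      (fun n p => ∑ k ∈ Finset.range (n + 1), e k p * d (n - k) p) := by
  choose Be hBe using hf.1
  choose Bd hBd using hg.1
  choose Ce hCe using hf.2
  choose Cd hCd using hg.2
  refine ⟨fun n => ⟨∑ k ∈ Finset.range (n + 1), Be k * Bd (n - k), fun p => ?_⟩, fun J =>
    ⟨Ce J * Cd 0 + ∑ i ∈ Finset.range J, Be i * Cd (J - i), fun p x hx hx0 => ?_⟩⟩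
  · refine (Finset.abs_sum_le_sum_abs _ _).trans (Finset.sum_le_sum fun k _ => ?_)
    rw [abs_mul]
    exact mul_le_mul (hBe k p) (hBd _ p) (abs_nonneg _) ((abs_nonneg _).trans (hBe k p))
  · have hdiag : ∑ n ∈ Finset.range J, (∑ k ∈ Finset.range (n + 1), e k p * d (n - k) p) * x ^ n =
        ∑ i ∈ Finset.range J, e i p * x ^ i * ∑ j ∈ Finset.range (J - i), d j p * x ^ j := by
      simp_rw [Finset.mul_sum]
      rw [← Finset.sum_range_diag_flip J fun i j => e i p * x ^ i * (d j p * x ^ j)]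
      refine Finset.sum_congr rfl fun n _ => ?_
      rw [Finset.sum_mul]
      refine Finset.sum_congr rfl fun k hk => ?_
      have : n = k + (n - k) := by have := Finset.mem_range.1 hk; omega
      conv_lhs => rw [this, pow_add, ← this]
      ring
    -- The i-th term of the first jet is paired with the jet of the second factor cut at J - i, so
    -- that every error has total order J.
    have hsplit : f p x * g p x -
        ∑ n ∈ Finset.range J, (∑ k ∈ Finset.range (n + 1), e k p * d (n - k) p) * x ^ n =
        (f p x - ∑ i ∈ Finset.range J, e i p * x ^ i) * g p x +
        ∑ i ∈ Finset.range J, e i p * x ^ i *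
          (g p x - ∑ j ∈ Finset.range (J - i), d j p * x ^ j) := by
      rw [hdiag]
      simp_rw [mul_sub, Finset.sum_sub_distrib, ← Finset.sum_mul]
      ring
    rw [hsplit, add_mul, Finset.sum_mul]
    refine (abs_add_le _ _).trans (add_le_add ?_
      ((Finset.abs_sum_le_sum_abs _ _).trans (Finset.sum_le_sum fun i hi => ?_)))
    · rw [abs_mul, mul_right_comm]
      have h1 := hCe J p x hx hx0
      have h2 : |g p x| ≤ Cd 0 := by simpa using hCd 0 p x hx hx0
      exact mul_le_mul h1 h2 (abs_nonneg _) ((abs_nonneg _).trans h1)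
    · have h1 := hCd (J - i) p x hx hx0
      have h2 := hBe i p
      have hJ : |x| ^ J = |x| ^ i * |x| ^ (J - i) := by
        rw [← pow_add]; congr 1; have := Finset.mem_range.1 hi; omega
      rw [abs_mul, abs_mul, abs_pow, hJ]
      calc |e i p| * |x| ^ i * _ ≤ Be i * |x| ^ i * (Cd (J - i) * |x| ^ (J - i)) := by
            refine mul_le_mul (by gcongr) h1 (abs_nonneg _) ?_
            have := (abs_nonneg _).trans h2
            positivity
        _ = _ := by ring

/-- The jet of `f p x ^ m * g p x`, where `f` and `g` have the jets `e` and `d`. -/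
noncomputable def powMulCoeff (e d : ℕ → P → ℝ) : ℕ → ℕ → P → ℝ
  | 0 => d
  | m + 1 => fun n p => ∑ k ∈ Finset.range (n + 1), e k p * powMulCoeff e d m (n - k) p

theorem pow_mul (hf : HasUniformJet f e) (hg : HasUniformJet g d) (m : ℕ) :
    HasUniformJet (fun p x => f p x ^ m * g p x) (powMulCoeff e d m) := by
  induction m with
  | zero =>
    simp_rw [pow_zero, one_mul]
    exact hg
  | succ m ih =>
    simp_rw [pow_succ', mul_assoc]
    exact hf.mul ih

end HasUniformJet

/-! ### Expanding the Laplace integrand about a Gaussian -/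

/-- The terms of weight `n` in the expansion of `exp (-M x ^ 3 h) a`, where `h ^ m a` has the jet
`c m`. -/
noncomputable def laplaceTerm {P : Type*} (c : ℕ → ℕ → P → ℝ) (p : P) (M x : ℝ) (n : ℕ) : ℝ :=
  ∑ m ∈ Finset.range (n + 1), (-M) ^ m / m.factorial * c m (n - m) p * x ^ (2 * m + n)

theorem sum_laplaceTerm {P : Type*} (c : ℕ → ℕ → P → ℝ) (p : P) (M x : ℝ) (K : ℕ) :
    ∑ n ∈ Finset.range K, laplaceTerm c p M x n =
      ∑ m ∈ Finset.range K, (-(M * x ^ 3)) ^ m / m.factorial *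
        ∑ j ∈ Finset.range (K - m), c m j p * x ^ j := by
  simp_rw [Finset.mul_sum]
  rw [← Finset.sum_range_diag_flip K fun m j =>
    (-(M * x ^ 3)) ^ m / m.factorial * (c m j p * x ^ j)]
  refine Finset.sum_congr rfl fun n _ => Finset.sum_congr rfl fun m hm => ?_
  have : 2 * m + n = 3 * m + (n - m) := by have := Finset.mem_range.1 hm; omega
  rw [this, pow_add, pow_mul, neg_pow (M * x ^ 3), neg_pow M, mul_pow]
  ring

/-- On the scale x ~ M^(-1/2) the monomial M^m x^(3m+j) has size M^(-(m+j)/2), so its weight is m +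
j. Cutting at weight K leaves errors M^m |x|^(2m+K) against a Gaussian of fixed width c₀, each
integrating to order M^(-(K+1)/2). -/
theorem exists_laplace_integrand_bound {P : Type*} {φ h a : P → ℝ → ℝ} {b : P → ℝ} {c₀ : ℝ}
    {e d : ℕ → P → ℝ} (hh : HasUniformJet h e) (ha : HasUniformJet a d)
    (hφ : ∀ p, ∀ x ∈ Icc (-1 : ℝ) 1, x ≠ 0 → φ p x = b p * x ^ 2 / 2 + x ^ 3 * h p x)
    (hb : ∀ p, c₀ ≤ b p) (hlow : ∀ p, ∀ x ∈ Icc (-1 : ℝ) 1, c₀ * x ^ 2 / 2 ≤ φ p x) (K : ℕ) :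
    ∃ C, 0 ≤ C ∧ ∀ p, ∀ M, 0 < M → ∀ x, x ≠ 0 →
      |(Icc (-1) 1).indicator (fun x => Real.exp (-(M * φ p x)) * a p x) x -
        Real.exp (-(M * (b p * x ^ 2 / 2))) * ∑ n ∈ Finset.range K,
          laplaceTerm (HasUniformJet.powMulCoeff e d) p M x n| ≤
      C * ((∑ m ∈ Finset.range (K + 1), M ^ m * |x| ^ (2 * m + K)) *
        Real.exp (-(M * (c₀ * x ^ 2 / 2)))) := by
  set c := HasUniformJet.powMulCoeff e d
  have hc (m : ℕ) := hh.pow_mul ha m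
  choose B hB using fun m => (hc m).1
  choose D hD using fun m => (hc m).2
  have hfac (n : ℕ) : (1 : ℝ) ≤ n.factorial := by
    exact_mod_cast Nat.one_le_iff_ne_zero.2 (Nat.factorial_ne_zero n)
  set C₁ := |D K 0| + ∑ m ∈ Finset.range K, |D m (K - m)|
  set C₂ := ∑ n ∈ Finset.range K, ∑ m ∈ Finset.range (n + 1), |B m (n - m)|
  refine ⟨C₁ + C₂, by positivity, fun p M hM x hx => ?_⟩
  set T := ∑ m ∈ Finset.range (K + 1), M ^ m * |x| ^ (2 * m + K)
  have hT0 : 0 ≤ T := Finset.sum_nonneg fun m _ => by positivity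
  have hT (m : ℕ) (hm : m ≤ K) : M ^ m * |x| ^ (2 * m + K) ≤ T :=
    Finset.single_le_sum (f := fun m => M ^ m * |x| ^ (2 * m + K)) (fun m _ => by positivity)
      (Finset.mem_range.2 (Nat.lt_succ_of_le hm))
  have hq : Real.exp (-(M * (b p * x ^ 2 / 2))) ≤ Real.exp (-(M * (c₀ * x ^ 2 / 2))) := by
    gcongr; exact hb p
  by_cases hx1 : x ∈ Icc (-1 : ℝ) 1
  · rw [indicator_of_mem hx1, sum_laplaceTerm]
    set q := Real.exp (-(M * (b p * x ^ 2 / 2)))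
    set w := M * x ^ 3 * h p x
    -- Two errors: the exponential series of -w cut at degree K, and for each m < K the jet of h^m a
    -- cut at order K - m.
    have hsplit : Real.exp (-(M * φ p x)) * a p x - q * ∑ m ∈ Finset.range K,
          (-(M * x ^ 3)) ^ m / m.factorial * ∑ j ∈ Finset.range (K - m), c m j p * x ^ j =
        q * (Real.exp (-w) - ∑ m ∈ Finset.range K, (-w) ^ m / m.factorial) * a p x +
        ∑ m ∈ Finset.range K, q * ((-(M * x ^ 3)) ^ m / m.factorial *
          (h p x ^ m * a p x - ∑ j ∈ Finset.range (K - m), c m j p * x ^ j)) := by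
      have h1 : Real.exp (-(M * φ p x)) = q * Real.exp (-w) := by
        rw [← Real.exp_add, hφ p x hx1 hx]; congr 1; ring
      have h2 : ∑ m ∈ Finset.range K, (-w) ^ m / m.factorial * a p x =
          ∑ m ∈ Finset.range K, (-(M * x ^ 3)) ^ m / m.factorial * (h p x ^ m * a p x) :=
        Finset.sum_congr rfl fun m _ => by
          rw [show -w = -(M * x ^ 3) * h p x by ring, mul_pow]; ring
      simp_rw [mul_sub, Finset.sum_sub_distrib, ← Finset.mul_sum, ← h2, ← Finset.sum_mul]
      rw [h1]; ring
    rw [hsplit]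
    have hmain : |q * (Real.exp (-w) - ∑ m ∈ Finset.range K, (-w) ^ m / m.factorial) * a p x| ≤
        |D K 0| * (T * Real.exp (-(M * (c₀ * x ^ 2 / 2)))) := by
      have hmax : q * max 1 (Real.exp (-w)) ≤ Real.exp (-(M * (c₀ * x ^ 2 / 2))) := by
        rw [mul_max_of_nonneg _ _ (Real.exp_nonneg _), mul_one, ← Real.exp_add]
        refine max_le hq (Real.exp_le_exp.2 ?_)
        have := mul_le_mul_of_nonneg_left (hlow p x hx1) hM.le
        rw [hφ p x hx1 hx] at this
        linarith [show w = M * (x ^ 3 * h p x) by ring]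
      have hDK : |h p x ^ K * a p x| ≤ |D K 0| := by
        have := hD K 0 p x hx1 hx
        simp only [Finset.range_zero, Finset.sum_empty, sub_zero, pow_zero, mul_one] at this
        exact this.trans (le_abs_self _)
      calc _ ≤ q * (|w| ^ K * max 1 (Real.exp (-w))) * |a p x| := by
            rw [abs_mul, abs_mul, Real.abs_exp]
            gcongr
            simpa using abs_exp_sub_sum_le (-w) K
        _ = |h p x ^ K * a p x| * (M ^ K * |x| ^ (2 * K + K)) * (q * max 1 (Real.exp (-w))) := by
            rw [show |w| = M * |x| ^ 3 * |h p x| by rw [abs_mul, abs_mul, abs_pow, abs_of_pos hM],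
              abs_mul, abs_pow, show 2 * K + K = 3 * K by ring, _root_.pow_mul, mul_pow, mul_pow]
            ring
        _ ≤ |D K 0| * T * Real.exp (-(M * (c₀ * x ^ 2 / 2))) := by
            gcongr
            exact hT K le_rfl
        _ = _ := by ring
    have hrest (m : ℕ) (hm : m ∈ Finset.range K) : |q * ((-(M * x ^ 3)) ^ m / m.factorial *
          (h p x ^ m * a p x - ∑ j ∈ Finset.range (K - m), c m j p * x ^ j))| ≤
        |D m (K - m)| * (T * Real.exp (-(M * (c₀ * x ^ 2 / 2)))) := by
      have hmK : m ≤ K := (Finset.mem_range.1 hm).le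
      have h1 := (hD m (K - m) p x hx1 hx).trans
        (mul_le_mul_of_nonneg_right (le_abs_self _) (by positivity))
      rw [abs_mul, abs_mul, Real.abs_exp, abs_div, abs_pow, abs_neg, abs_mul, abs_pow,
        abs_of_pos hM, Nat.abs_cast]
      calc _ ≤ Real.exp (-(M * (c₀ * x ^ 2 / 2))) *
            ((M * |x| ^ 3) ^ m * (|D m (K - m)| * |x| ^ (K - m))) := by
            gcongr
            exact div_le_self (by positivity) (hfac m)
        _ = |D m (K - m)| * (M ^ m * |x| ^ (2 * m + K) * Real.exp (-(M * (c₀ * x ^ 2 / 2)))) := by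
            rw [show 2 * m + K = 3 * m + (K - m) by omega, pow_add, _root_.pow_mul, mul_pow]
            ring
        _ ≤ _ := by
            gcongr
            exact hT m hmK
    refine (abs_add_le _ _).trans ((add_le_add hmain ((Finset.abs_sum_le_sum_abs _ _).trans
      (Finset.sum_le_sum hrest))).trans ?_)
    rw [← Finset.sum_mul, ← add_mul]
    exact mul_le_mul_of_nonneg_right (le_add_of_nonneg_right (by positivity)) (by positivity)
  -- Off [-1, 1] only the polynomial terms survive. As |x| ≥ 1, their powers 2m + n may be raised to
  -- 2m + K.
  · have hx1' : 1 ≤ |x| := by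
      by_contra! hlt
      exact hx1 (abs_le.1 hlt.le)
    rw [indicator_of_notMem hx1, zero_sub, abs_neg, abs_mul, Real.abs_exp]
    have hsum : |∑ n ∈ Finset.range K, laplaceTerm c p M x n| ≤ C₂ * T := by
      rw [Finset.sum_mul]
      refine (Finset.abs_sum_le_sum_abs _ _).trans (Finset.sum_le_sum fun n hn => ?_)
      rw [Finset.sum_mul]
      refine (Finset.abs_sum_le_sum_abs _ _).trans (Finset.sum_le_sum fun m hm => ?_)
      have hnK := Finset.mem_range.1 hn
      have hmn := Finset.mem_range.1 hm
      rw [abs_mul, abs_mul, abs_div, abs_pow, abs_pow, abs_neg, abs_of_pos hM, Nat.abs_cast]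
      have hBm := (hB m (n - m) p).trans (le_abs_self _)
      calc _ ≤ M ^ m * |B m (n - m)| * |x| ^ (2 * m + K) := by
            gcongr
            exact div_le_self (by positivity) (hfac m)
        _ = |B m (n - m)| * (M ^ m * |x| ^ (2 * m + K)) := by ring
        _ ≤ _ := by
            gcongr
            exact hT m (by omega)
    calc _ ≤ Real.exp (-(M * (c₀ * x ^ 2 / 2))) * (C₂ * T) := by gcongr
      _ = C₂ * (T * Real.exp (-(M * (c₀ * x ^ 2 / 2)))) := by ring
      _ ≤ _ := by
        gcongr
        exact le_add_of_nonneg_left (by positivity)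

/-! ### Gaussian moments and the coefficients of the expansion -/

theorem integrable_pow_mul_exp_neg_mul_sq {c : ℝ} (hc : 0 < c) (n : ℕ) :
    Integrable fun x : ℝ => x ^ n * Real.exp (-(c * x ^ 2 / 2)) := by
  have h := integrable_rpow_mul_exp_neg_mul_sq (b := c / 2) (by positivity)
    (s := n) (by linarith [n.cast_nonneg (α := ℝ)])
  simp_rw [Real.rpow_natCast] at h
  refine h.congr (.of_forall fun x => ?_)
  simp only
  congr 2; ring

theorem integrable_abs_pow_mul_exp_neg_mul_sq {c : ℝ} (hc : 0 < c) (n : ℕ) :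
    Integrable fun x : ℝ => |x| ^ n * Real.exp (-(c * x ^ 2 / 2)) := by
  refine (integrable_pow_mul_exp_neg_mul_sq hc n).norm.congr (.of_forall fun x => ?_)
  simp

theorem integral_abs_pow_mul_exp_neg_mul_sq_scale {c s : ℝ} (hs : 0 < s) (n : ℕ) :
    ∫ x : ℝ, |x| ^ n * Real.exp (-(s ^ 2 * (c * x ^ 2 / 2))) =
      (s⁻¹) ^ (n + 1) * ∫ x : ℝ, |x| ^ n * Real.exp (-(c * x ^ 2 / 2)) := by
  have h := Measure.integral_comp_mul_left (fun x : ℝ => |x| ^ n * Real.exp (-(c * x ^ 2 / 2))) s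
  rw [abs_of_pos (inv_pos.2 hs), smul_eq_mul] at h
  rw [pow_succ s⁻¹ n, mul_assoc, ← h, ← integral_const_mul]
  congr 1; ext x
  rw [abs_mul, abs_of_pos hs, mul_pow, ← mul_assoc, ← mul_assoc, ← mul_pow,
    inv_mul_cancel₀ hs.ne', one_pow, one_mul]
  congr 2; ring

/-- The moments `∫ x ^ n exp (-x ^ 2 / 2)`. -/
noncomputable def gaussMoment (n : ℕ) : ℝ := ∫ x : ℝ, x ^ n * Real.exp (-(x ^ 2 / 2))

theorem gaussMoment_zero : gaussMoment 0 = √(2 * Real.pi) := by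
  have h := integral_gaussian (1 / 2)
  rw [gaussMoment, show 2 * Real.pi = Real.pi / (1 / 2) by ring, ← h]
  congr 1; ext x
  rw [pow_zero, one_mul]; congr 1; ring

theorem gaussMoment_of_odd {n : ℕ} (hn : Odd n) : gaussMoment n = 0 := by
  have h := integral_neg_eq_self (fun x : ℝ => x ^ n * Real.exp (-(x ^ 2 / 2))) volume
  simp_rw [hn.neg_pow, neg_sq, neg_mul, integral_neg] at h
  rw [gaussMoment]; linarith

theorem integral_pow_mul_exp_neg_mul_sq_scale {s : ℝ} (hs : 0 < s) (n : ℕ) :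
    ∫ x : ℝ, x ^ n * Real.exp (-(s ^ 2 * x ^ 2 / 2)) = (s⁻¹) ^ (n + 1) * gaussMoment n := by
  have h := Measure.integral_comp_mul_left (fun x : ℝ => x ^ n * Real.exp (-(x ^ 2 / 2))) s
  rw [abs_of_pos (inv_pos.2 hs), smul_eq_mul] at h
  rw [gaussMoment, pow_succ s⁻¹ n, mul_assoc, ← h, ← integral_const_mul]
  congr 1; ext x
  rw [← mul_pow, mul_pow s x n, ← mul_assoc, ← mul_assoc, ← mul_pow s⁻¹ s,
    inv_mul_cancel₀ hs.ne', one_pow, one_mul]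

/-- The coefficient of weight `n` in the Gaussian integral of the terms `laplaceTerm c`. -/
noncomputable def laplaceCoeff {P : Type*} (c : ℕ → ℕ → P → ℝ) (β : P → ℝ) (n : ℕ) (p : P) : ℝ :=
  ∑ m ∈ Finset.range (n + 1), (-1) ^ m / m.factorial * c m (n - m) p *
    ((β p)⁻¹ ^ (2 * m + n + 1) * gaussMoment (2 * m + n))

section LaplaceCoeff

variable {P : Type*} {c : ℕ → ℕ → P → ℝ} {β : P → ℝ}

theorem laplaceCoeff_of_odd {n : ℕ} (hn : Odd n) (p : P) : laplaceCoeff c β n p = 0 :=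
  Finset.sum_eq_zero fun m _ => by
    rw [gaussMoment_of_odd ((even_two_mul m).add_odd hn), mul_zero, mul_zero]

theorem exists_laplaceCoeff_bound (hc : ∀ m j, ∃ B, ∀ p, |c m j p| ≤ B) {β₀ : ℝ} (hβ₀ : 0 < β₀)
    (hβ : ∀ p, β₀ ≤ β p) (n : ℕ) : ∃ B, ∀ p, |laplaceCoeff c β n p| ≤ B := by
  choose B hB using hc
  refine ⟨∑ m ∈ Finset.range (n + 1), 1 * |B m (n - m)| *
    (β₀⁻¹ ^ (2 * m + n + 1) * |gaussMoment (2 * m + n)|), fun p => ?_⟩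
  refine (Finset.abs_sum_le_sum_abs _ _).trans (Finset.sum_le_sum fun m _ => ?_)
  have hp : 0 < β p := hβ₀.trans_le (hβ p)
  have hfac : (1 : ℝ) ≤ m.factorial := by
    exact_mod_cast Nat.one_le_iff_ne_zero.2 (Nat.factorial_ne_zero m)
  have hBm := (hB m (n - m) p).trans (le_abs_self _)
  rw [abs_mul, abs_mul, abs_mul, abs_div, abs_pow, abs_neg, abs_one, one_pow, Nat.abs_cast,
    abs_pow, abs_of_pos (inv_pos.2 hp)]
  gcongr
  · exact div_le_self zero_le_one hfac
  · exact hβ p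

theorem integrable_exp_mul_laplaceTerm {s : ℝ} (hs : 0 < s) (p : P) (hβ : 0 < β p) (n : ℕ) :
    Integrable fun x => Real.exp (-(s ^ 2 * (β p ^ 2 * x ^ 2 / 2))) * laplaceTerm c p (s ^ 2) x n := by
  simp_rw [laplaceTerm, Finset.mul_sum]
  refine integrable_finsetSum _ fun m _ => ?_
  refine ((integrable_pow_mul_exp_neg_mul_sq (c := (s * β p) ^ 2) (by positivity)
    (2 * m + n)).const_mul ((-s ^ 2) ^ m / m.factorial * c m (n - m) p)).congr
    (.of_forall fun x => ?_)
  simp only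
  rw [show s ^ 2 * (β p ^ 2 * x ^ 2 / 2) = (s * β p) ^ 2 * x ^ 2 / 2 by ring]
  ring

theorem integral_exp_mul_laplaceTerm {s : ℝ} (hs : 0 < s) (p : P) (hβ : 0 < β p) (n : ℕ) :
    ∫ x, Real.exp (-(s ^ 2 * (β p ^ 2 * x ^ 2 / 2))) * laplaceTerm c p (s ^ 2) x n =
      s⁻¹ ^ (n + 1) * laplaceCoeff c β n p := by
  have hint (m : ℕ) : Integrable fun x : ℝ => (-s ^ 2) ^ m / m.factorial * c m (n - m) p *
      (x ^ (2 * m + n) * Real.exp (-((s * β p) ^ 2 * x ^ 2 / 2))) :=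
    (integrable_pow_mul_exp_neg_mul_sq (by positivity) _).const_mul _
  have heq (x : ℝ) : Real.exp (-(s ^ 2 * (β p ^ 2 * x ^ 2 / 2))) * laplaceTerm c p (s ^ 2) x n =
      ∑ m ∈ Finset.range (n + 1), (-s ^ 2) ^ m / m.factorial * c m (n - m) p *
        (x ^ (2 * m + n) * Real.exp (-((s * β p) ^ 2 * x ^ 2 / 2))) := by
    rw [laplaceTerm, Finset.mul_sum]
    refine Finset.sum_congr rfl fun m _ => ?_
    rw [show s ^ 2 * (β p ^ 2 * x ^ 2 / 2) = (s * β p) ^ 2 * x ^ 2 / 2 by ring]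
    ring
  simp_rw [heq]
  rw [integral_finsetSum _ fun m _ => hint m, laplaceCoeff, Finset.mul_sum]
  refine Finset.sum_congr rfl fun m _ => ?_
  rw [integral_const_mul, integral_pow_mul_exp_neg_mul_sq_scale (by positivity), mul_inv, mul_pow,
    neg_pow]
  have : (s ^ 2) ^ m * s⁻¹ ^ (2 * m + n + 1) = s⁻¹ ^ (n + 1) := by
    rw [← pow_mul, add_assoc, pow_add, ← mul_assoc, ← mul_pow, mul_inv_cancel₀ hs.ne', one_pow,
      one_mul]
  rw [← this]; ring

/-- Odd weights vanish by parity, so with s = √M only integral powers of M remain beside the common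
factor s⁻¹. -/
theorem sum_laplaceCoeff (s : ℝ) (p : P) (R : ℕ) :
    ∑ n ∈ Finset.range (2 * R), s⁻¹ ^ (n + 1) * laplaceCoeff c β n p =
      s⁻¹ * ∑ k ∈ Finset.range R, laplaceCoeff c β (2 * k) p / (s ^ 2) ^ k := by
  induction R with
  | zero => simp
  | succ R ih =>
    rw [show 2 * (R + 1) = 2 * R + 1 + 1 by ring, Finset.sum_range_succ, Finset.sum_range_succ, ih,
      laplaceCoeff_of_odd ⟨R, rfl⟩, Finset.sum_range_succ, mul_zero, add_zero, mul_add, ← pow_mul,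
      div_eq_mul_inv, ← inv_pow]
    ring

end LaplaceCoeff

/-! ### The uniform Laplace expansion -/

/-- Laplace's method for `∫ exp (-M φ) a` over `[-1, 1]`, with coefficients and remainders bounded
uniformly in a family of phases `φ p` and amplitudes `a p`. -/
theorem exists_laplace_expansion_of_jet {P : Type*} {φ h a : P → ℝ → ℝ} {β : P → ℝ} {β₀ : ℝ}
    {e d : ℕ → P → ℝ} (hh : HasUniformJet h e) (ha : HasUniformJet a d)
    (hφc : ∀ p, Continuous (φ p)) (hac : ∀ p, Continuous (a p))
    (hφ : ∀ p, ∀ x ∈ Icc (-1 : ℝ) 1, x ≠ 0 → φ p x = β p ^ 2 * x ^ 2 / 2 + x ^ 3 * h p x)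
    (hβ₀ : 0 < β₀) (hβ : ∀ p, β₀ ≤ β p)
    (hlow : ∀ p, ∀ x ∈ Icc (-1 : ℝ) 1, β₀ ^ 2 * x ^ 2 / 2 ≤ φ p x) (R : ℕ) :
    ∃ C, ∀ p, ∀ s, 0 < s →
      |(∫ x in Icc (-1) 1, Real.exp (-(s ^ 2 * φ p x)) * a p x) -
        s⁻¹ * ∑ k ∈ Finset.range R,
          laplaceCoeff (HasUniformJet.powMulCoeff e d) β (2 * k) p / (s ^ 2) ^ k| ≤
      C * (s⁻¹ / (s ^ 2) ^ R) := by
  -- Weight 2R corresponds to M^(-R), because each unit of weight is worth s⁻¹ = M^(-1/2).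
  obtain ⟨C, hC0, hC⟩ := exists_laplace_integrand_bound hh ha hφ
    (fun p => pow_le_pow_left₀ hβ₀.le (hβ p) 2) hlow (2 * R)
  refine ⟨C * ∑ m ∈ Finset.range (2 * R + 1),
    ∫ x : ℝ, |x| ^ (2 * m + 2 * R) * Real.exp (-(β₀ ^ 2 * x ^ 2 / 2)), fun p s hs => ?_⟩
  have hβp : 0 < β p := hβ₀.trans_le (hβ p)
  have hI1 : Integrable
      ((Icc (-1) 1).indicator fun x => Real.exp (-(s ^ 2 * φ p x)) * a p x) := by
    rw [integrable_indicator_iff measurableSet_Icc]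
    have := hφc p
    have := hac p
    exact (by fun_prop : Continuous fun x => Real.exp (-(s ^ 2 * φ p x)) * a p x).integrableOn_Icc
  have hI2 : Integrable fun x => Real.exp (-(s ^ 2 * (β p ^ 2 * x ^ 2 / 2))) *
      ∑ n ∈ Finset.range (2 * R), laplaceTerm (HasUniformJet.powMulCoeff e d) p (s ^ 2) x n := by
    simp_rw [Finset.mul_sum]
    exact integrable_finsetSum _ fun n _ => integrable_exp_mul_laplaceTerm hs p hβp n
  have hJ (m : ℕ) : Integrable fun x : ℝ => (s ^ 2) ^ m *
      (|x| ^ (2 * m + 2 * R) * Real.exp (-(s ^ 2 * (β₀ ^ 2 * x ^ 2 / 2)))) := by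
    refine ((integrable_abs_pow_mul_exp_neg_mul_sq (c := (s * β₀) ^ 2) (by positivity)
      (2 * m + 2 * R)).const_mul ((s ^ 2) ^ m)).congr (.of_forall fun x => ?_)
    simp only
    rw [show s ^ 2 * (β₀ ^ 2 * x ^ 2 / 2) = (s * β₀) ^ 2 * x ^ 2 / 2 by ring]
  have hint2 : ∫ x, Real.exp (-(s ^ 2 * (β p ^ 2 * x ^ 2 / 2))) *
      ∑ n ∈ Finset.range (2 * R), laplaceTerm (HasUniformJet.powMulCoeff e d) p (s ^ 2) x n =
      s⁻¹ * ∑ k ∈ Finset.range R,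
          laplaceCoeff (HasUniformJet.powMulCoeff e d) β (2 * k) p / (s ^ 2) ^ k := by
    simp_rw [Finset.mul_sum]
    rw [integral_finsetSum _ fun n _ => integrable_exp_mul_laplaceTerm hs p hβp n]
    simp_rw [integral_exp_mul_laplaceTerm hs p hβp]
    rw [sum_laplaceCoeff, Finset.mul_sum]
  have hbound (x : ℝ) : C * ((∑ m ∈ Finset.range (2 * R + 1), (s ^ 2) ^ m *
      |x| ^ (2 * m + 2 * R)) * Real.exp (-(s ^ 2 * (β₀ ^ 2 * x ^ 2 / 2)))) =
      C * ∑ m ∈ Finset.range (2 * R + 1), (s ^ 2) ^ m *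
      (|x| ^ (2 * m + 2 * R) * Real.exp (-(s ^ 2 * (β₀ ^ 2 * x ^ 2 / 2)))) := by
    simp_rw [Finset.sum_mul, mul_assoc]
  rw [← integral_indicator measurableSet_Icc, ← hint2, ← integral_sub hI1 hI2, ← Real.norm_eq_abs]
  refine (norm_integral_le_of_norm_le
    ((integrable_finsetSum (Finset.range (2 * R + 1)) fun m _ => hJ m).const_mul C)
    (?_ : ∀ᵐ x, _)).trans_eq ?_
  · filter_upwards [Measure.ae_ne volume (0 : ℝ)] with x hx
    rw [← hbound]
    exact hC p (s ^ 2) (by positivity) x hx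
  · rw [integral_const_mul, integral_finsetSum _ fun m _ => hJ m, mul_assoc, Finset.sum_mul]
    congr 1
    refine Finset.sum_congr rfl fun m _ => ?_
    rw [integral_const_mul, integral_abs_pow_mul_exp_neg_mul_sq_scale hs]
    have : (s ^ 2) ^ m * s⁻¹ ^ (2 * m + 2 * R + 1) = s⁻¹ / (s ^ 2) ^ R := by
      rw [← pow_mul, add_assoc, pow_add, ← mul_assoc, ← mul_pow, mul_inv_cancel₀ hs.ne', one_pow,
        one_mul, pow_succ', ← pow_mul, div_eq_mul_inv, inv_pow]
    rw [← this]; ring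

/-- The amplitude is φ'' itself, so with β² = φ''(0) the leading term is √(2π) β²/β = √(2π) β.
Dividing by it normalizes the zeroth coefficient to 1, and β ≥ √c keeps the others bounded. -/
theorem exists_uniform_laplace_expansion {P : Type*} {φ : P → ℝ → ℝ} {c : ℝ}
    (hφ : ∀ p, ContDiff ℝ ∞ (φ p)) (h0 : ∀ p, φ p 0 = 0) (h1 : ∀ p, deriv (φ p) 0 = 0)
    (hB : ∀ n, ∃ B, ∀ p, ∀ x ∈ Icc (-1 : ℝ) 1, |iteratedDeriv n (φ p) x| ≤ B) (hc : 0 < c)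
    (hφc : ∀ p, ∀ x ∈ Icc (-1 : ℝ) 1, c ≤ iteratedDeriv 2 (φ p) x) :
    ∃ A : ℕ → P → ℝ, (∀ k, ∃ B, ∀ p, |A k p| ≤ B) ∧ (∀ p, A 0 p = 1) ∧
      ∀ R : ℕ, ∃ C, ∀ p, ∀ M, 0 < M →
        |(∫ x in Icc (-1) 1, Real.exp (-(M * φ p x)) * iteratedDeriv 2 (φ p) x) -
          √(2 * Real.pi) * (√(iteratedDeriv 2 (φ p) 0) / √M) *
            ∑ k ∈ Finset.range (R + 1), A k p / M ^ k| ≤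
        C * (√(iteratedDeriv 2 (φ p) 0) / √M / M ^ (R + 1)) := by
  have hiter (n : ℕ) (p : P) : iteratedDeriv n (iteratedDeriv 2 (φ p)) =
      iteratedDeriv (n + 2) (φ p) := by
    simp_rw [iteratedDeriv_eq_iterate, Function.iterate_add_apply]
  have hasmooth (p : P) : ContDiff ℝ ∞ (iteratedDeriv 2 (φ p)) := by
    rw [iteratedDeriv_eq_iterate]
    exact (hφ p).iterate_deriv 2
  have hjet := HasUniformJet.of_iteratedDeriv_bound hφ hB
  have ha := HasUniformJet.of_iteratedDeriv_bound (f := fun p => iteratedDeriv 2 (φ p)) hasmooth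
    fun n => (hB (n + 2)).imp fun B h p => by rw [hiter]; exact h p
  have hh := hjet.shift 3
  set β : P → ℝ := fun p => √(iteratedDeriv 2 (φ p) 0)
  have hβsq (p : P) : β p ^ 2 = iteratedDeriv 2 (φ p) 0 :=
    Real.sq_sqrt (hc.le.trans (hφc p 0 (by norm_num)))
  have hβ (p : P) : √c ≤ β p := Real.sqrt_le_sqrt (hφc p 0 (by norm_num))
  have hβ₀ : 0 < √c := Real.sqrt_pos.2 hc
  have hβpos (p : P) : 0 < β p := hβ₀.trans_le (hβ p)
  have htaylor (p : P) (x : ℝ) (hx : x ≠ 0) : φ p x = β p ^ 2 * x ^ 2 / 2 + x ^ 3 *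
      ((φ p x - ∑ j ∈ Finset.range 3, iteratedDeriv j (φ p) 0 / j.factorial * x ^ j) / x ^ 3) := by
    rw [mul_div_cancel₀ _ (pow_ne_zero 3 hx), hβsq]
    simp [Finset.sum_range_succ, h0, h1, iteratedDeriv_one]
    ring
  have hlow (p : P) (x : ℝ) (hx : x ∈ Icc (-1 : ℝ) 1) : √c ^ 2 * x ^ 2 / 2 ≤ φ p x := by
    rcases eq_or_ne x 0 with rfl | hx0
    · simp [h0]
    obtain ⟨y, hy, h⟩ := exists_taylor_remainder (hφ p) hx0 2
    have hy1 : y ∈ Icc (-1 : ℝ) 1 :=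
      (uIcc_subset_Icc (by norm_num) hx : uIcc 0 x ⊆ Icc (-1) 1) hy
    simp [Finset.sum_range_succ, h0, h1, iteratedDeriv_one] at h
    rw [h, Real.sq_sqrt hc.le]
    gcongr
    exact hφc p y hy1
  have hexp := exists_laplace_expansion_of_jet hh ha (fun p => (hφ p).continuous)
    (fun p => (hasmooth p).continuous) (fun p x _ hx => htaylor p x hx) hβ₀ hβ hlow
  set cf := HasUniformJet.powMulCoeff
    (fun j p => iteratedDeriv (j + 3) (φ p) 0 / ((j + 3).factorial : ℝ))
    (fun j p => iteratedDeriv j (iteratedDeriv 2 (φ p)) 0 / (j.factorial : ℝ))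
  have hpi : 0 < √(2 * Real.pi) := by positivity
  refine ⟨fun k p => laplaceCoeff cf β (2 * k) p / (√(2 * Real.pi) * β p), fun k => ?_,
    fun p => ?_, fun R => ?_⟩
  · obtain ⟨B, hB⟩ := exists_laplaceCoeff_bound (c := cf) (fun m => (hh.pow_mul ha m).1) hβ₀ hβ
      (2 * k)
    refine ⟨|B| / (√(2 * Real.pi) * √c), fun p => ?_⟩
    rw [abs_div, abs_of_pos (mul_pos hpi (hβpos p))]
    have h1 := (hB p).trans (le_abs_self _)
    have h2 := hβ p
    gcongr
  · have : laplaceCoeff cf β 0 p = √(2 * Real.pi) * β p := by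
      simp only [laplaceCoeff, zero_add, Finset.range_one, Finset.sum_singleton, mul_zero,
        gaussMoment_zero, pow_zero, pow_one, Nat.factorial_zero, Nat.cast_one, div_one, one_mul,
        Nat.sub_zero, cf, HasUniformJet.powMulCoeff, iteratedDeriv_zero, ← hβsq]
      field_simp [(hβpos p).ne']
    simp only [mul_zero, this]
    exact div_self (mul_pos hpi (hβpos p)).ne'
  · obtain ⟨C, hC⟩ := hexp (R + 1)
    -- The Laplace error has no factor √φ''(0); it is inserted using √c ≤ √φ''(0).
    refine ⟨|C| / √c, fun p M hM => ?_⟩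
    have h := hC p (√M) (Real.sqrt_pos.2 hM)
    rw [Real.sq_sqrt hM.le] at h
    have hsum : √(2 * Real.pi) * (β p / √M) * ∑ k ∈ Finset.range (R + 1),
          laplaceCoeff cf β (2 * k) p / (√(2 * Real.pi) * β p) / M ^ k =
        (√M)⁻¹ * ∑ k ∈ Finset.range (R + 1), laplaceCoeff cf β (2 * k) p / M ^ k := by
      simp_rw [Finset.mul_sum]
      refine Finset.sum_congr rfl fun k _ => ?_
      have := (hβpos p).ne'
      field_simp
    rw [hsum]
    refine h.trans ?_
    calc C * ((√M)⁻¹ / M ^ (R + 1)) ≤ |C| * ((√M)⁻¹ / M ^ (R + 1)) := by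
          gcongr; exact le_abs_self _
      _ = |C| / √c * (√c / √M / M ^ (R + 1)) := by field_simp
      _ ≤ _ := by gcongr; exact hφc p 0 (by norm_num)

/-! ### Families smooth up to the ends of the parameter interval -/

section SmoothFamilies

variable {E : Type*} [NormedAddCommGroup E] [NormedSpace ℝ E] {f : ℝ → E → ℝ}

theorem contDiff_of_contDiffOn_family
    (hf : ContDiffOn ℝ ∞ (fun p : ℝ × E => f p.1 p.2) (Icc (0 : ℝ) 1 ×ˢ univ)) {t : ℝ}
    (ht : t ∈ Icc (0 : ℝ) 1) : ContDiff ℝ ∞ (f t) := by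
  rw [← contDiffOn_univ]
  exact hf.comp (g := fun p : ℝ × E => f p.1 p.2) (f := fun x : E => (t, x))
    (contDiff_const.prodMk contDiff_id).contDiffOn fun x _ => ⟨ht, mem_univ x⟩

/-- The joint derivative is taken within the strip because t reaches the endpoints. In the
directions (0, e) it is an ordinary derivative, since whole slices {t} × E lie in the strip. -/
theorem contDiffOn_fderiv_family
    (hf : ContDiffOn ℝ ∞ (fun p : ℝ × E => f p.1 p.2) (Icc (0 : ℝ) 1 ×ˢ univ)) (e : E) :
    ContDiffOn ℝ ∞ (fun p : ℝ × E => fderiv ℝ (f p.1) p.2 e) (Icc (0 : ℝ) 1 ×ˢ univ) := by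
  have hS : UniqueDiffOn ℝ (Icc (0 : ℝ) 1 ×ˢ (univ : Set E)) :=
    (uniqueDiffOn_Icc zero_lt_one).prod uniqueDiffOn_univ
  have h1 : ContDiffOn ℝ ∞ (fun p => fderivWithin ℝ (fun p : ℝ × E => f p.1 p.2)
      (Icc (0 : ℝ) 1 ×ˢ univ) p (0, e)) (Icc (0 : ℝ) 1 ×ˢ univ) :=
    (hf.fderivWithin hS (by simp)).clm_apply contDiffOn_const
  refine h1.congr fun p hp => ?_
  have h2 := ((hf.differentiableOn (by simp)) p hp).hasFDerivWithinAt
  have h3 : HasFDerivAt (fun x : E => (p.1, x)) (ContinuousLinearMap.inr ℝ ℝ E) p.2 :=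
    hasFDerivAt_prodMk_right p.1 p.2
  have h4 := (h2.comp (g := fun p : ℝ × E => f p.1 p.2) p.2 (h3.hasFDerivWithinAt (s := univ))
    (show MapsTo (fun x : E => (p.1, x)) univ (Icc (0 : ℝ) 1 ×ˢ univ) from
      fun x _ => ⟨hp.1, mem_univ x⟩)).hasFDerivAt Filter.univ_mem
  have h5 : fderiv ℝ (f p.1) p.2 = _ := h4.fderiv
  rw [h5]; simp

end SmoothFamilies

/-! ### Toric metrics in the logarithmic coordinate -/

namespace IsToricPositiveMetric

variable {H : ℂ × ℂ → ℝ}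

theorem chart_ne_zero (z : ℂ) : ((1 : ℂ), z) ≠ 0 := by simp

theorem contDiff_kahlerPotential (hH : IsToricPositiveMetric H) :
    ContDiff ℝ ∞ (kahlerPotential H) := by
  have h1 : ContDiff ℝ ∞ fun z : ℂ => H (1, z) := by
    rw [← contDiffOn_univ]
    exact hH.smooth.comp (contDiff_const.prodMk contDiff_id).contDiffOn
      fun z _ => chart_ne_zero z
  exact h1.log fun z => (hH.pos _ (chart_ne_zero z)).ne'

theorem kahlerPotential_norm (hH : IsToricPositiveMetric H) (z : ℂ) :
    kahlerPotential H (‖z‖ : ℂ) = kahlerPotential H z := by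
  rcases eq_or_ne z 0 with rfl | hz
  · simp
  have hn : (‖z‖ : ℂ) ≠ 0 := by simpa using hz
  have h := hH.invariant (z / ‖z‖) (1, ‖z‖) (by simp [hz])
  rw [div_mul_cancel₀ _ hn] at h
  rw [kahlerPotential, kahlerPotential, h]

theorem kahlerPotential_eq_logPotential (hH : IsToricPositiveMetric H) {z : ℂ} (hz : z ≠ 0) :
    kahlerPotential H z = logPotential H (Real.log (‖z‖ ^ 2)) := by
  rw [logPotential, Real.log_pow, Nat.cast_ofNat, mul_div_cancel_left₀ _ two_ne_zero,
    Real.exp_log (norm_pos_iff.2 hz), hH.kahlerPotential_norm]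

theorem contDiff_logPotential (hH : IsToricPositiveMetric H) : ContDiff ℝ ∞ (logPotential H) := by
  have h : ContDiff ℝ ∞ fun ρ : ℝ => ((Real.exp (ρ / 2) : ℝ) : ℂ) :=
    Complex.ofRealCLM.contDiff.comp (Real.contDiff_exp.comp (contDiff_id.div_const 2))
  exact hH.contDiff_kahlerPotential.comp h

/-- Exchanging the charts reduces ρ → +∞ to ρ → -∞. Circle invariance survives because diag(c, 1) =
c · diag(1, c⁻¹) and |c| = 1. -/
theorem swap (hH : IsToricPositiveMetric H) : IsToricPositiveMetric (fun v => H (v.2, v.1)) where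
  pos v hv := hH.pos _ fun h => hv (by simpa [Prod.ext_iff, and_comm] using h)
  homogeneous c v := hH.homogeneous c (v.2, v.1)
  smooth := hH.smooth.comp (contDiff_snd.prodMk contDiff_fst).contDiffOn
    fun v hv h => hv (by simpa [Prod.ext_iff, and_comm] using h)
  invariant c v hc := by
    have hc0 : c ≠ 0 := by rintro rfl; simp at hc
    have h1 := hH.invariant c⁻¹ (c * v.2, c * v.1) (by simp [hc])
    have h2 := hH.homogeneous c (v.2, v.1)
    simp only [Prod.smul_mk, smul_eq_mul, hc, one_pow, one_mul, inv_mul_cancel_left₀ hc0] at h1 h2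
    rw [← h2, ← h1]
  curvature_pos := hH.curvature_pos_infty
  curvature_pos_infty := hH.curvature_pos

theorem logPotential_eq_swap (hH : IsToricPositiveMetric H) (ρ : ℝ) :
    logPotential H ρ = ρ + logPotential (fun v => H (v.2, v.1)) (-ρ) := by
  set r := Real.exp (ρ / 2)
  have hr : 0 < r := Real.exp_pos _
  have hinv : Real.exp (-ρ / 2) = r⁻¹ := by rw [neg_div, Real.exp_neg]
  have hpos := hH.pos (((r⁻¹ : ℝ) : ℂ), 1) (by simp)
  have h := hH.homogeneous (r : ℂ) (((r⁻¹ : ℝ) : ℂ), 1)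
  have hr' : (r : ℂ) ≠ 0 := by exact_mod_cast hr.ne'
  simp only [Prod.smul_mk, smul_eq_mul, Complex.ofReal_inv, mul_inv_cancel₀ hr', mul_one,
    Complex.norm_real, Real.norm_eq_abs, abs_of_pos hr] at h
  simp only [logPotential, kahlerPotential, hinv, Complex.ofReal_inv]
  rw [Complex.ofReal_inv] at hpos
  change Real.log (H (1, (r : ℂ))) = _
  rw [h, Real.log_mul (by positivity) hpos.ne', Real.log_pow, Real.log_exp]
  ring

theorem laplacian_kahlerPotential_eq (hH : IsToricPositiveMetric H) (z : ℂ) :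
    Δ (kahlerPotential H) z =
      fderiv ℝ (fun y => fderiv ℝ (kahlerPotential H) y 1) z 1 +
        fderiv ℝ (fun y => fderiv ℝ (kahlerPotential H) y Complex.I) z Complex.I := by
  have hd : DifferentiableAt ℝ (fderiv ℝ (kahlerPotential H)) z :=
    ((hH.contDiff_kahlerPotential.fderiv_right (m := ∞) (by simp)).differentiable (by simp)) z
  have h (e : ℂ) : fderiv ℝ (fun y => fderiv ℝ (kahlerPotential H) y e) z e =
      fderiv ℝ (fderiv ℝ (kahlerPotential H)) z e e := by
    rw [fderiv_clm_apply hd (differentiableAt_const e)]; simp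
  rw [h, h, InnerProductSpace.laplacian_eq_iteratedFDeriv_complexPlane]
  simp [iteratedFDeriv_two_apply]

theorem fderiv_kahlerPotential (hH : IsToricPositiveMetric H) {z : ℂ} (hz : z ≠ 0) (e : ℂ) :
    fderiv ℝ (kahlerPotential H) z e =
      deriv (logPotential H) (Real.log (‖z‖ ^ 2)) * (2 * inner ℝ z e / ‖z‖ ^ 2) := by
  have hU := (hH.contDiff_logPotential.differentiable (by simp)
    (Real.log (‖z‖ ^ 2))).hasDerivAt
  have hL := (hasStrictFDerivAt_norm_sq z).hasFDerivAt.log (by simpa using hz)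
  have h := (hU.comp_hasFDerivAt z hL).congr_of_eventuallyEq
    (show kahlerPotential H =ᶠ[nhds z] _ from by
      filter_upwards [isOpen_ne.mem_nhds hz] with y hy
      exact hH.kahlerPotential_eq_logPotential hy)
  rw [h.fderiv]
  simp only [smul_apply, innerSL_apply_apply, smul_eq_mul, nsmul_eq_mul,
    Nat.cast_ofNat]
  ring

theorem fderiv_fderiv_kahlerPotential (hH : IsToricPositiveMetric H) {z : ℂ} (hz : z ≠ 0) (e : ℂ) :
    fderiv ℝ (fun y => fderiv ℝ (kahlerPotential H) y e) z e =
      iteratedDeriv 2 (logPotential H) (Real.log (‖z‖ ^ 2)) * (2 * inner ℝ z e / ‖z‖ ^ 2) ^ 2 +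
      deriv (logPotential H) (Real.log (‖z‖ ^ 2)) *
        (2 * inner ℝ e e / ‖z‖ ^ 2 - (2 * inner ℝ z e / ‖z‖ ^ 2) ^ 2) := by
  have hn : ‖z‖ ^ 2 ≠ 0 := by simpa using hz
  have hU : HasDerivAt (deriv (logPotential H))
      (iteratedDeriv 2 (logPotential H) (Real.log (‖z‖ ^ 2))) (Real.log (‖z‖ ^ 2)) := by
    rw [iteratedDeriv_succ, iteratedDeriv_one]
    exact ((hH.contDiff_logPotential.iterate_deriv 1).differentiable (by simp) _).hasDerivAt
  have hN := (hasStrictFDerivAt_norm_sq z).hasFDerivAt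
  have hL := hN.log hn
  have hI : HasFDerivAt (fun y : ℂ => 2 * inner ℝ y e) ((2 : ℝ) • (innerSL ℝ e : ℂ →L[ℝ] ℝ)) z := by
    have : (fun y : ℂ => 2 * inner ℝ y e) = ((2 : ℝ) • (innerSL ℝ e : ℂ →L[ℝ] ℝ)) := by
      ext y; simp [real_inner_comm]
    rw [this]; exact ((2 : ℝ) • (innerSL ℝ e : ℂ →L[ℝ] ℝ)).hasFDerivAt
  have h := ((hU.comp_hasFDerivAt z hL).mul (hI.mul ((hasDerivAt_inv hn).comp_hasFDerivAt z hN)))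
  have h' := h.congr_of_eventuallyEq
    (show (fun y => fderiv ℝ (kahlerPotential H) y e) =ᶠ[nhds z] _ from by
      filter_upwards [isOpen_ne.mem_nhds hz] with y hy
      rw [hH.fderiv_kahlerPotential hy]
      simp only [Pi.mul_apply, Function.comp_apply, div_eq_mul_inv])
  rw [h'.fderiv]
  simp
  field_simp
  ring

/-- The first-order terms in U' cancel because log |z|² is harmonic off 0; what is left is U'' |∇
log |z|²|². -/
theorem laplacian_kahlerPotential (hH : IsToricPositiveMetric H) {z : ℂ} (hz : z ≠ 0) :
    Δ (kahlerPotential H) z =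
      4 * iteratedDeriv 2 (logPotential H) (Real.log (‖z‖ ^ 2)) / ‖z‖ ^ 2 := by
  have hn : ‖z‖ ^ 2 ≠ 0 := by simpa using hz
  rw [hH.laplacian_kahlerPotential_eq, hH.fderiv_fderiv_kahlerPotential hz,
    hH.fderiv_fderiv_kahlerPotential hz]
  have h1 : inner ℝ z 1 = z.re := by simp [Complex.inner]
  have h2 : inner ℝ z Complex.I = z.im := by simp [Complex.inner]
  have h3 : ‖z‖ ^ 2 = z.re ^ 2 + z.im ^ 2 := by
    rw [← Complex.normSq_eq_norm_sq, Complex.normSq_apply]; ring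
  rw [h1, h2, real_inner_self_eq_norm_sq, real_inner_self_eq_norm_sq]
  simp only [norm_one, Complex.norm_I]
  field_simp
  rw [h3]
  ring

theorem iteratedDeriv_two_logPotential (hH : IsToricPositiveMetric H) (ρ : ℝ) :
    iteratedDeriv 2 (logPotential H) ρ =
      Real.exp ρ / 4 * Δ (kahlerPotential H) (Real.exp (ρ / 2) : ℝ) := by
  have hexp : Real.exp (ρ / 2) ^ 2 = Real.exp ρ := by
    rw [← Real.exp_nat_mul]; congr 1; push_cast; ring
  rw [hH.laplacian_kahlerPotential (by exact_mod_cast (Real.exp_pos _).ne'), Complex.norm_real,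
    Real.norm_eq_abs, abs_of_pos (Real.exp_pos _), hexp, Real.log_exp]
  field_simp

theorem iteratedDeriv_two_logPotential_pos (hH : IsToricPositiveMetric H) (ρ : ℝ) :
    0 < iteratedDeriv 2 (logPotential H) ρ := by
  rw [hH.iteratedDeriv_two_logPotential]
  exact mul_pos (by positivity) (hH.curvature_pos _)

end IsToricPositiveMetric

/-! ### Bounds of order e^ρ for the derivatives of U -/

/-- The operator `(r / 2) ∂_r`, which is `∂_ρ` in the coordinate `r = exp (ρ / 2)`. -/
noncomputable def eulerOp (w : ℝ → ℝ → ℝ) : ℝ → ℝ → ℝ := fun t r => r / 2 * deriv (w t) r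

/-- The family `w t`, `t ∈ [0, 1]`, is smooth in all variables and vanishes to second order
at `0`. -/
structure VanishesToSecondOrder (w : ℝ → ℝ → ℝ) : Prop where
  smooth : ContDiffOn ℝ ∞ (fun p : ℝ × ℝ => w p.1 p.2) (Icc (0 : ℝ) 1 ×ˢ univ)
  zero : ∀ t ∈ Icc (0 : ℝ) 1, w t 0 = 0
  deriv_zero : ∀ t ∈ Icc (0 : ℝ) 1, deriv (w t) 0 = 0

theorem contDiffOn_deriv_family {w : ℝ → ℝ → ℝ}
    (hw : ContDiffOn ℝ ∞ (fun p : ℝ × ℝ => w p.1 p.2) (Icc (0 : ℝ) 1 ×ˢ univ)) :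
    ContDiffOn ℝ ∞ (fun p : ℝ × ℝ => deriv (w p.1) p.2) (Icc (0 : ℝ) 1 ×ˢ univ) := by
  simpa only [fderiv_apply_one_eq_deriv] using contDiffOn_fderiv_family hw 1

/-- Only w'(0) = 0 is needed: (r/2) w' vanishes at 0 with derivative w'(0)/2. Thus the operator can
be iterated starting from an even function. -/
theorem VanishesToSecondOrder.eulerOp_of_deriv_zero {w : ℝ → ℝ → ℝ}
    (hw : ContDiffOn ℝ ∞ (fun p : ℝ × ℝ => w p.1 p.2) (Icc (0 : ℝ) 1 ×ˢ univ))
    (h0 : ∀ t ∈ Icc (0 : ℝ) 1, deriv (w t) 0 = 0) : VanishesToSecondOrder (eulerOp w) where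
  smooth := (contDiff_snd.div_const 2).contDiffOn.mul (contDiffOn_deriv_family hw)
  zero t _ := by simp [eulerOp]
  deriv_zero t ht := by
    have h1 : HasDerivAt (deriv (w t)) (deriv (deriv (w t)) 0) 0 :=
      (((contDiff_of_contDiffOn_family hw ht).iterate_deriv 1).differentiable
        (by simp) 0).hasDerivAt
    have h2 := ((hasDerivAt_id (0 : ℝ)).div_const 2).mul h1
    refine h2.deriv.trans ?_
    simp [h0 t ht]

theorem exists_bound_of_contDiffOn_family {w : ℝ → ℝ → ℝ}
    (hw : ContDiffOn ℝ ∞ (fun p : ℝ × ℝ => w p.1 p.2) (Icc (0 : ℝ) 1 ×ˢ univ)) (a : ℝ) :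
    ∃ C, 0 ≤ C ∧ ∀ t ∈ Icc (0 : ℝ) 1, ∀ r ∈ Icc 0 a, |w t r| ≤ C := by
  obtain ⟨C, hC⟩ := (isCompact_Icc.prod isCompact_Icc).exists_bound_of_continuousOn
    (hw.continuousOn.mono (prod_mono_right (subset_univ (Icc 0 a))))
  exact ⟨|C|, abs_nonneg _, fun t ht r hr => (hC (t, r) ⟨ht, hr⟩).trans (le_abs_self _)⟩

theorem VanishesToSecondOrder.exists_le_sq {w : ℝ → ℝ → ℝ} (hw : VanishesToSecondOrder w) (a : ℝ) :
    ∃ C, 0 ≤ C ∧ ∀ t ∈ Icc (0 : ℝ) 1, ∀ r ∈ Icc 0 a, |w t r| ≤ C * r ^ 2 := by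
  obtain ⟨C, hC0, hC⟩ := exists_bound_of_contDiffOn_family (w := fun t => deriv (deriv (w t)))
    (contDiffOn_deriv_family (w := fun t => deriv (w t)) (contDiffOn_deriv_family hw.smooth)) a
  refine ⟨C, hC0, fun t ht r hr => ?_⟩
  have hs := contDiff_of_contDiffOn_family hw.smooth ht
  have h1 (x : ℝ) (hx : x ∈ Icc 0 r) : ‖deriv (w t) x‖ ≤ C * r := by
    have h := (convex_Icc 0 r).norm_image_sub_le_of_norm_deriv_le (f := deriv (w t)) (C := C)
      (fun y _ => (hs.iterate_deriv 1).differentiable (by simp) y)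
      (fun y hy => hC t ht y ⟨hy.1, hy.2.trans hr.2⟩) (left_mem_Icc.2 hr.1) hx
    rw [hw.deriv_zero t ht, sub_zero, sub_zero, Real.norm_of_nonneg hx.1] at h
    exact h.trans (mul_le_mul_of_nonneg_left hx.2 hC0)
  have h := (convex_Icc 0 r).norm_image_sub_le_of_norm_deriv_le (f := w t)
    (fun y _ => hs.differentiable (by simp) y) h1 (left_mem_Icc.2 hr.1) (right_mem_Icc.2 hr.1)
  rw [hw.zero t ht, sub_zero, sub_zero, Real.norm_of_nonneg hr.1] at h
  exact h.trans_eq (by ring)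

theorem iteratedDeriv_comp_exp_half {w : ℝ → ℝ → ℝ}
    (hw : ContDiffOn ℝ ∞ (fun p : ℝ × ℝ => w p.1 p.2) (Icc (0 : ℝ) 1 ×ˢ univ)) (n : ℕ) :
    ContDiffOn ℝ ∞ (fun p : ℝ × ℝ => (eulerOp^[n] w) p.1 p.2) (Icc (0 : ℝ) 1 ×ˢ univ) ∧
    ∀ t ∈ Icc (0 : ℝ) 1, iteratedDeriv n (fun ρ => w t (Real.exp (ρ / 2))) =
      fun ρ => (eulerOp^[n] w) t (Real.exp (ρ / 2)) := by
  induction n with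
  | zero => exact ⟨hw, fun t _ => by simp⟩
  | succ n ih =>
    simp only [Function.iterate_succ_apply']
    refine ⟨(contDiff_snd.div_const 2).contDiffOn.mul (contDiffOn_deriv_family ih.1),
      fun t ht => ?_⟩
    rw [iteratedDeriv_succ, ih.2 t ht]
    ext ρ
    have h1 := ((contDiff_of_contDiffOn_family ih.1 ht).differentiable (by simp)
      (Real.exp (ρ / 2))).hasDerivAt
    have h2 := ((hasDerivAt_id ρ).div_const 2).exp
    refine (h1.comp ρ h2).deriv.trans ?_
    simp only [eulerOp, id]
    ring

/-- A path of toric positively curved metrics on `O(1)`, smooth in all variables. -/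
structure IsToricPath (H : ℝ → ℂ × ℂ → ℝ) : Prop where
  metric : ∀ t ∈ Icc (0 : ℝ) 1, IsToricPositiveMetric (H t)
  smooth : ContDiffOn ℝ ∞ (fun p : ℝ × (ℂ × ℂ) => H p.1 p.2) (Icc (0 : ℝ) 1 ×ˢ {0}ᶜ)

theorem IsToricGeodesic.isToricPath {H : ℝ → ℂ × ℂ → ℝ} (hH : IsToricGeodesic H) : IsToricPath H :=
  ⟨hH.metric, hH.smooth⟩

namespace IsToricPath

variable {H : ℝ → ℂ × ℂ → ℝ}

theorem swap (hH : IsToricPath H) : IsToricPath (fun t v => H t (v.2, v.1)) where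
  metric t ht := (hH.metric t ht).swap
  smooth := hH.smooth.comp (contDiff_fst.prodMk
      ((contDiff_snd.comp contDiff_snd).prodMk (contDiff_fst.comp contDiff_snd))).contDiffOn
    fun p hp => ⟨hp.1, fun h => hp.2 (by simpa [Prod.ext_iff, and_comm] using h)⟩

theorem contDiffOn_kahlerPotential (hH : IsToricPath H) :
    ContDiffOn ℝ ∞ (fun p : ℝ × ℂ => kahlerPotential (H p.1) p.2) (Icc (0 : ℝ) 1 ×ˢ univ) := by
  have h1 : ContDiffOn ℝ ∞ (fun p : ℝ × ℂ => H p.1 (1, p.2)) (Icc (0 : ℝ) 1 ×ˢ univ) :=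
    hH.smooth.comp (contDiff_fst.prodMk (contDiff_const.prodMk contDiff_snd)).contDiffOn
      fun p hp => ⟨hp.1, IsToricPositiveMetric.chart_ne_zero p.2⟩
  exact h1.log fun p hp =>
    ((hH.metric p.1 hp.1).pos _ (IsToricPositiveMetric.chart_ne_zero p.2)).ne'

/-- A continuous positive function on the compact set [0, 1] × {|z| ≤ a} has a positive minimum. It
includes z = 0, which is what makes the bound uniform as ρ → -∞. -/
theorem exists_le_laplacian (hH : IsToricPath H) (a : ℝ) :
    ∃ c, 0 < c ∧ ∀ t ∈ Icc (0 : ℝ) 1, ∀ z : ℂ, ‖z‖ ≤ a → c ≤ Δ (kahlerPotential (H t)) z := by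
  rcases lt_or_ge a 0 with ha | ha
  · exact ⟨1, one_pos, fun t _ z hz => absurd (norm_nonneg z) (by linarith)⟩
  have hs := hH.contDiffOn_kahlerPotential
  have hcont : ContinuousOn (fun p : ℝ × ℂ => Δ (kahlerPotential (H p.1)) p.2)
      (Icc (0 : ℝ) 1 ×ˢ univ) := by
    have h (e : ℂ) := contDiffOn_fderiv_family
      (f := fun t z => fderiv ℝ (kahlerPotential (H t)) z e) (contDiffOn_fderiv_family (f := fun t => kahlerPotential (H t)) hs e) e
    refine ((h 1).add (h Complex.I)).continuousOn.congr fun p hp => ?_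
    exact (hH.metric p.1 hp.1).laplacian_kahlerPotential_eq p.2
  obtain ⟨p, hp, hmin⟩ := (isCompact_Icc.prod (isCompact_closedBall (0 : ℂ) a)).exists_isMinOn
    ⟨(0, 0), by simpa using ha⟩ (hcont.mono (prod_mono_right (subset_univ _)))
  refine ⟨_, (hH.metric p.1 hp.1).curvature_pos p.2, fun t ht z hz => ?_⟩
  exact isMinOn_iff.1 hmin (t, z) ⟨ht, by simpa using hz⟩

theorem exists_le_iteratedDeriv_two (hH : IsToricPath H) (a : ℝ) :
    ∃ c, 0 < c ∧ ∀ t ∈ Icc (0 : ℝ) 1, ∀ ρ ≤ a,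
      c * Real.exp ρ ≤ iteratedDeriv 2 (logPotential (H t)) ρ := by
  obtain ⟨c, hc, h⟩ := hH.exists_le_laplacian (Real.exp (a / 2))
  refine ⟨c / 4, by positivity, fun t ht ρ hρ => ?_⟩
  have h1 := h t ht (Real.exp (ρ / 2) : ℝ) (by
    rw [Complex.norm_real, Real.norm_eq_abs, Real.abs_exp]
    gcongr)
  rw [(hH.metric t ht).iteratedDeriv_two_logPotential]
  have := mul_le_mul_of_nonneg_left h1 (Real.exp_pos ρ).le
  linarith

/-- U is v(exp(ρ/2)) with v even in r, so v'(0) = 0. After at least one application of (r/2) ∂_r the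
result is O(r²) = O(e^ρ). -/
theorem exists_iteratedDeriv_le (hH : IsToricPath H) {n : ℕ} (hn : n ≠ 0) (a : ℝ) :
    ∃ C, 0 ≤ C ∧ ∀ t ∈ Icc (0 : ℝ) 1, ∀ ρ ≤ a,
      |iteratedDeriv n (logPotential (H t)) ρ| ≤ C * Real.exp ρ := by
  set v : ℝ → ℝ → ℝ := fun t r => kahlerPotential (H t) (r : ℂ)
  have hv : ContDiffOn ℝ ∞ (fun p : ℝ × ℝ => v p.1 p.2) (Icc (0 : ℝ) 1 ×ˢ univ) :=
    hH.contDiffOn_kahlerPotential.comp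
      (contDiff_fst.prodMk (Complex.ofRealCLM.contDiff.comp contDiff_snd)).contDiffOn
      fun p hp => ⟨hp.1, mem_univ _⟩
  have hv0 (t : ℝ) (ht : t ∈ Icc (0 : ℝ) 1) : deriv (v t) 0 = 0 := by
    have heven : (fun r => v t (-r)) = v t := by
      ext r
      simp only [v]
      rw [← (hH.metric t ht).kahlerPotential_norm, ← (hH.metric t ht).kahlerPotential_norm (r : ℂ)]
      simp
    have := deriv_comp_neg (v t) 0
    rw [heven, neg_zero] at this
    linarith
  have hvan (k : ℕ) : VanishesToSecondOrder (eulerOp^[k + 1] v) := by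
    induction k with
    | zero => exact VanishesToSecondOrder.eulerOp_of_deriv_zero hv hv0
    | succ k ih =>
      rw [Function.iterate_succ_apply']
      exact VanishesToSecondOrder.eulerOp_of_deriv_zero ih.smooth ih.deriv_zero
  obtain ⟨k, rfl⟩ := Nat.exists_eq_succ_of_ne_zero hn
  obtain ⟨C, hC0, hC⟩ := (hvan k).exists_le_sq (Real.exp (a / 2))
  refine ⟨C, hC0, fun t ht ρ hρ => ?_⟩
  have h := (iteratedDeriv_comp_exp_half hv (k + 1)).2 t ht
  change |iteratedDeriv (k + 1) (fun ρ => v t (Real.exp (ρ / 2))) ρ| ≤ _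
  rw [h]
  refine (hC t ht _ ⟨(Real.exp_pos _).le, by gcongr⟩).trans_eq ?_
  rw [← Real.exp_nat_mul]
  congr 2
  push_cast
  ring

end IsToricPath

/-! ### The moment map U', the Legendre transform and the norming integral -/

namespace IsToricPositiveMetric

variable {H : ℂ × ℂ → ℝ}

theorem isToricPath_const (hH : IsToricPositiveMetric H) : IsToricPath fun _ => H where
  metric _ _ := hH
  smooth := hH.smooth.comp contDiff_snd.contDiffOn fun _ hp => hp.2

theorem hasDerivAt_logPotential (hH : IsToricPositiveMetric H) (ρ : ℝ) :
    HasDerivAt (logPotential H) (deriv (logPotential H) ρ) ρ :=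
  (hH.contDiff_logPotential.differentiable (by simp) ρ).hasDerivAt

theorem contDiff_deriv_logPotential (hH : IsToricPositiveMetric H) :
    ContDiff ℝ ∞ (deriv (logPotential H)) :=
  hH.contDiff_logPotential.iterate_deriv 1

theorem hasDerivAt_deriv_logPotential (hH : IsToricPositiveMetric H) (ρ : ℝ) :
    HasDerivAt (deriv (logPotential H)) (iteratedDeriv 2 (logPotential H) ρ) ρ := by
  rw [iteratedDeriv_succ, iteratedDeriv_one]
  exact (hH.contDiff_deriv_logPotential.differentiable (by simp) ρ).hasDerivAt

theorem deriv_logPotential_eq_swap (hH : IsToricPositiveMetric H) (ρ : ℝ) :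
    deriv (logPotential H) ρ = 1 - deriv (logPotential fun v => H (v.2, v.1)) (-ρ) := by
  have h := (hasDerivAt_id ρ).add
    ((hH.swap.hasDerivAt_logPotential (-ρ)).comp ρ (hasDerivAt_neg ρ))
  have h' : logPotential H = _ := funext hH.logPotential_eq_swap
  rw [h']
  refine h.deriv.trans ?_
  ring

theorem tendsto_deriv_logPotential_atBot (hH : IsToricPositiveMetric H) :
    Filter.Tendsto (deriv (logPotential H)) Filter.atBot (nhds 0) := by
  obtain ⟨C, -, hC⟩ := hH.isToricPath_const.exists_iteratedDeriv_le one_ne_zero 0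
  refine squeeze_zero_norm' (a := fun ρ => C * Real.exp ρ) ?_ ?_
  · filter_upwards [Filter.eventually_le_atBot 0] with ρ hρ
    simpa [iteratedDeriv_one] using hC 0 (by simp) ρ hρ
  · simpa using Real.tendsto_exp_atBot.const_mul C

theorem tendsto_deriv_logPotential_atTop (hH : IsToricPositiveMetric H) :
    Filter.Tendsto (deriv (logPotential H)) Filter.atTop (nhds 1) := by
  have h := (hH.swap.tendsto_deriv_logPotential_atBot.comp
    Filter.tendsto_neg_atTop_atBot).const_sub 1
  rw [sub_zero] at h
  exact h.congr fun ρ => (hH.deriv_logPotential_eq_swap ρ).symm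

theorem strictMono_deriv_logPotential (hH : IsToricPositiveMetric H) :
    StrictMono (deriv (logPotential H)) :=
  strictMono_of_deriv_pos fun ρ => by
    rw [(hH.hasDerivAt_deriv_logPotential ρ).deriv]
    exact hH.iteratedDeriv_two_logPotential_pos ρ

theorem integrable_iteratedDeriv_two_logPotential (hH : IsToricPositiveMetric H) :
    Integrable (iteratedDeriv 2 (logPotential H)) := by
  rw [← integrableOn_univ, ← Iic_union_Ioi (a := (0 : ℝ)), integrableOn_union]
  refine ⟨?_, integrableOn_Ioi_deriv_of_nonneg' (fun x _ => hH.hasDerivAt_deriv_logPotential x)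
    (fun x _ => (hH.iteratedDeriv_two_logPotential_pos x).le)
    hH.tendsto_deriv_logPotential_atTop⟩
  rw [← (Measure.measurePreserving_neg volume).integrableOn_comp_preimage
    (Homeomorph.neg ℝ).measurableEmbedding]
  simp only [neg_preimage, neg_Iic, neg_zero]
  rw [integrableOn_Ici_iff_integrableOn_Ioi]
  refine integrableOn_Ioi_deriv_of_nonneg' (g := fun x => -deriv (logPotential H) (-x))
    (fun x _ => ?_) (fun x _ => (hH.iteratedDeriv_two_logPotential_pos (-x)).le)
    (hH.tendsto_deriv_logPotential_atBot.comp Filter.tendsto_neg_atTop_atBot).neg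
  exact ((hH.hasDerivAt_deriv_logPotential (-x)).comp x (hasDerivAt_neg x)).neg.congr_deriv
    (by simp)

theorem integral_iteratedDeriv_two_logPotential (hH : IsToricPositiveMetric H) :
    ∫ ρ, iteratedDeriv 2 (logPotential H) ρ = 1 := by
  simpa using integral_of_hasDerivAt_of_tendsto hH.hasDerivAt_deriv_logPotential
    hH.integrable_iteratedDeriv_two_logPotential hH.tendsto_deriv_logPotential_atBot
    hH.tendsto_deriv_logPotential_atTop

theorem exists_deriv_logPotential_eq (hH : IsToricPositiveMetric H) {α : ℝ} (hα : α ∈ Ioo (0 : ℝ) 1) :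
    ∃ ρ, deriv (logPotential H) ρ = α := by
  refine mem_range_of_exists_le_of_exists_ge hH.contDiff_deriv_logPotential.continuous ?_ ?_
  · exact ((hH.tendsto_deriv_logPotential_atBot.eventually_lt_const hα.1).exists).imp
      fun _ h => h.le
  · exact ((hH.tendsto_deriv_logPotential_atTop.eventually_const_lt hα.2).exists).imp
      fun _ h => h.le

theorem monotoneOn_sub (hH : IsToricPositiveMetric H) (ρ : ℝ) :
    MonotoneOn (fun x => logPotential H x - deriv (logPotential H) ρ * x) (Ici ρ) := by
  have hd (x : ℝ) := (hH.hasDerivAt_logPotential x).sub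
    ((hasDerivAt_id x).const_mul (deriv (logPotential H) ρ))
  refine monotoneOn_of_deriv_nonneg (convex_Ici ρ)
    (fun x _ => (hd x).continuousAt.continuousWithinAt)
    (fun x _ => (hd x).differentiableAt.differentiableWithinAt) fun x hx => ?_
  rw [interior_Ici] at hx
  refine le_of_le_of_eq ?_ (hd x).deriv.symm
  have := hH.strictMono_deriv_logPotential hx
  linarith

theorem antitoneOn_sub (hH : IsToricPositiveMetric H) (ρ : ℝ) :
    AntitoneOn (fun x => logPotential H x - deriv (logPotential H) ρ * x) (Iic ρ) := by
  have hd (x : ℝ) := (hH.hasDerivAt_logPotential x).sub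
    ((hasDerivAt_id x).const_mul (deriv (logPotential H) ρ))
  refine antitoneOn_of_deriv_nonpos (convex_Iic ρ)
    (fun x _ => (hd x).continuousAt.continuousWithinAt)
    (fun x _ => (hd x).differentiableAt.differentiableWithinAt) fun x hx => ?_
  rw [interior_Iic] at hx
  refine le_of_eq_of_le (hd x).deriv ?_
  have := hH.strictMono_deriv_logPotential hx
  linarith

theorem legendre_le (hH : IsToricPositiveMetric H) (ρ x : ℝ) :
    deriv (logPotential H) ρ * x - logPotential H x ≤
      deriv (logPotential H) ρ * ρ - logPotential H ρ := by
  rcases le_total ρ x with h | h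
  · have := hH.monotoneOn_sub ρ self_mem_Ici h h
    simp only at this
    linarith
  · have := hH.antitoneOn_sub ρ h self_mem_Iic h
    simp only at this
    linarith

theorem symplecticPotential_deriv (hH : IsToricPositiveMetric H) (ρ : ℝ) :
    symplecticPotential H (deriv (logPotential H) ρ) =
      deriv (logPotential H) ρ * ρ - logPotential H ρ :=
  le_antisymm (ciSup_le (hH.legendre_le ρ))
    (le_ciSup (f := fun x => deriv (logPotential H) ρ * x - logPotential H x)
      ⟨_, forall_mem_range.2 (hH.legendre_le ρ)⟩ ρ)

theorem exists_smooth_inverse (hH : IsToricPositiveMetric H) (ρ : ℝ) :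
    ∃ ψ : ℝ → ℝ, ContDiffAt ℝ ∞ ψ (deriv (logPotential H) ρ) ∧ ψ (deriv (logPotential H) ρ) = ρ ∧
      ∀ᶠ x in nhds (deriv (logPotential H) ρ), deriv (logPotential H) (ψ x) = x := by
  have h0 := (hH.iteratedDeriv_two_logPotential_pos ρ).ne'
  have hf := hH.contDiff_deriv_logPotential.contDiffAt (x := ρ)
  have hf' : HasFDerivAt (deriv (logPotential H)) (ContinuousLinearEquiv.unitsEquivAut ℝ
      (Units.mk0 _ h0) : ℝ →L[ℝ] ℝ) ρ := by
    have := (hH.hasDerivAt_deriv_logPotential ρ).hasFDerivAt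
    refine this.congr_fderiv (ContinuousLinearMap.ext_ring ?_)
    simp
  exact ⟨hf.localInverse hf' (by simp), hf.to_localInverse hf' (by simp),
    hf.localInverse_apply_image hf' (by simp),
    (hf.hasStrictFDerivAt' hf' (by simp)).eventually_right_inverse⟩

/-- Near α, G(x) = xψ(x) - U(ψ(x)) with ψ the local inverse of U'. The terms in ψ' cancel, so G' = ψ
and G'' = 1/U''. -/
theorem contDiffAt_symplecticPotential (hH : IsToricPositiveMetric H) (ρ : ℝ) :
    ContDiffAt ℝ ∞ (symplecticPotential H) (deriv (logPotential H) ρ) ∧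
      iteratedDeriv 2 (symplecticPotential H) (deriv (logPotential H) ρ) =
        (iteratedDeriv 2 (logPotential H) ρ)⁻¹ := by
  obtain ⟨ψ, hψ, hψρ, hinv⟩ := hH.exists_smooth_inverse ρ
  set α := deriv (logPotential H) ρ
  have hG : symplecticPotential H =ᶠ[nhds α] fun x => x * ψ x - logPotential H (ψ x) := by
    filter_upwards [hinv] with x hx
    conv_lhs => rw [← hx]
    rw [hH.symplecticPotential_deriv, hx]
  refine ⟨((contDiffAt_id.mul hψ).sub
    (hH.contDiff_logPotential.contDiffAt.comp α hψ)).congr_of_eventuallyEq hG, ?_⟩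
  have hψd : ∀ᶠ x in nhds α, DifferentiableAt ℝ ψ x := by
    filter_upwards [(hψ.of_le (m := 1) (by exact_mod_cast le_top)).eventually (by simp)] with x hx
    exact hx.differentiableAt (by simp)
  have hG' : deriv (symplecticPotential H) =ᶠ[nhds α] ψ := by
    refine hG.deriv.trans ?_
    filter_upwards [hψd, hinv] with x hx hix
    have h := ((hasDerivAt_id x).mul hx.hasDerivAt).sub
      ((hH.hasDerivAt_logPotential (ψ x)).comp x hx.hasDerivAt)
    refine h.deriv.trans ?_
    rw [hix, id]; ring
  rw [iteratedDeriv_succ, iteratedDeriv_one, hG'.deriv_eq]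
  have h1 := (hH.hasDerivAt_deriv_logPotential (ψ α)).comp α hψd.self_of_nhds.hasDerivAt
  have h2 := (hasDerivAt_id α).congr_of_eventuallyEq (f₁ := deriv (logPotential H) ∘ ψ) hinv
  have h3 := h1.unique h2
  rw [hψρ] at h3
  exact eq_inv_of_mul_eq_one_right h3

/-- The radial profile of the integrand `|z ^ (N α)|²_{h^N} ω` on the affine chart. -/
noncomputable def radialDensity (H : ℂ × ℂ → ℝ) (N : ℕ) (α r : ℝ) : ℝ :=
  Real.exp (N * (α * Real.log (r ^ 2) - logPotential H (Real.log (r ^ 2)))) *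
    (2 * iteratedDeriv 2 (logPotential H) (Real.log (r ^ 2)) / r ^ 2)

theorem monomialNormSq_mul_kahlerDensity (hH : IsToricPositiveMetric H) (N : ℕ) (α : ℝ) {z : ℂ}
    (hz : z ≠ 0) : monomialNormSq H N α z * kahlerDensity H z =
      radialDensity H N α ‖z‖ := by
  have hn := norm_pos_iff.2 hz
  have hp : H (1, z) = Real.exp (logPotential H (Real.log (‖z‖ ^ 2))) := by
    rw [← hH.kahlerPotential_eq_logPotential hz, kahlerPotential,
      Real.exp_log (hH.pos _ (chart_ne_zero z))]
  simp only [monomialNormSq, kahlerDensity, radialDensity]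
  rw [hH.laplacian_kahlerPotential hz, hp, ← Real.exp_nat_mul, Real.rpow_def_of_pos hn,
    ← Real.exp_sub]
  congr 1
  · congr 1
    rw [Real.log_pow]; push_cast; ring
  · ring

theorem exp_half_image : (fun ρ : ℝ => Real.exp (ρ / 2)) '' univ = Ioi 0 := by
  ext r
  simp only [image_univ, mem_range, mem_Ioi]
  refine ⟨fun ⟨ρ, h⟩ => h ▸ Real.exp_pos _, fun h => ⟨2 * Real.log r, ?_⟩⟩
  rw [mul_div_cancel_left₀ _ two_ne_zero, Real.exp_log h]

/-- With r = exp(ρ/2), the polar weight r and the Jacobian r/2 cancel the factor 2/r² of the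
density. -/
theorem abs_deriv_mul_exp_half (H : ℂ × ℂ → ℝ) (N : ℕ) (α ρ : ℝ) :
    |Real.exp (ρ / 2) * (1 / 2)| •
      (Real.exp (ρ / 2) ^ (2 - 1) • radialDensity H N α (Real.exp (ρ / 2))) =
    Real.exp (N * (α * ρ - logPotential H ρ)) * iteratedDeriv 2 (logPotential H) ρ := by
  have h : Real.log (Real.exp (ρ / 2) ^ 2) = ρ := by
    rw [Real.log_pow, Real.log_exp]; push_cast; ring
  rw [radialDensity, h, abs_of_pos (by positivity), smul_eq_mul, smul_eq_mul, Nat.add_one_sub_one,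
    pow_one]
  have := (Real.exp_pos (ρ / 2)).ne'
  field_simp

/-- The exponential is bounded by its value at the critical point, and U'' is integrable. -/
theorem integrable_exp_mul (hH : IsToricPositiveMetric H) (N : ℕ) {α : ℝ}
    (hα : α ∈ Ioo (0 : ℝ) 1) : Integrable fun ρ =>
      Real.exp (N * (α * ρ - logPotential H ρ)) * iteratedDeriv 2 (logPotential H) ρ := by
  obtain ⟨ρ₀, rfl⟩ := hH.exists_deriv_logPotential_eq hα
  have hc := hH.contDiff_logPotential.continuous
  refine hH.integrable_iteratedDeriv_two_logPotential.bdd_mul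
    (c := Real.exp (N * (deriv (logPotential H) ρ₀ * ρ₀ - logPotential H ρ₀)))
    (by fun_prop : Continuous fun ρ => Real.exp (N * (deriv (logPotential H) ρ₀ * ρ -
      logPotential H ρ))).aestronglyMeasurable (.of_forall fun ρ => ?_)
  rw [Real.norm_eq_abs, Real.abs_exp]
  exact Real.exp_le_exp.2 (mul_le_mul_of_nonneg_left (hH.legendre_le ρ₀ ρ) N.cast_nonneg)

theorem ae_monomialNormSq_mul_kahlerDensity (hH : IsToricPositiveMetric H) (N : ℕ) (α : ℝ) :
    (fun z : ℂ => monomialNormSq H N α z * kahlerDensity H z) =ᵐ[volume] fun z =>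
      radialDensity H N α ‖z‖ := by
  filter_upwards [Measure.ae_ne volume (0 : ℂ)] with z hz
  exact hH.monomialNormSq_mul_kahlerDensity N α hz

theorem hasDerivWithinAt_exp_half (ρ : ℝ) (s : Set ℝ) :
    HasDerivWithinAt (fun ρ : ℝ => Real.exp (ρ / 2)) (Real.exp (ρ / 2) * (1 / 2)) s ρ :=
  ((hasDerivAt_id ρ).div_const 2).exp.hasDerivWithinAt

theorem injective_exp_half : Function.Injective fun ρ : ℝ => Real.exp (ρ / 2) := fun a b h => by
  have := Real.exp_injective h
  linarith

theorem integrable_monomialNormSq_mul (hH : IsToricPositiveMetric H) (N : ℕ) {α : ℝ}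
    (hα : α ∈ Ioo (0 : ℝ) 1) :
    Integrable fun z : ℂ => monomialNormSq H N α z * kahlerDensity H z := by
  rw [integrable_congr (hH.ae_monomialNormSq_mul_kahlerDensity N α), integrable_fun_norm_addHaar volume (f := radialDensity H N α),
    Complex.finrank_real_complex, ← exp_half_image,
    integrableOn_image_iff_integrableOn_abs_deriv_smul .univ
      (fun ρ _ => hasDerivWithinAt_exp_half ρ univ) injective_exp_half.injOn, integrableOn_univ]
  simp_rw [abs_deriv_mul_exp_half]
  exact hH.integrable_exp_mul N hα

theorem monomialL2NormSq_eq (hH : IsToricPositiveMetric H) (N : ℕ) (α : ℝ) :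
    monomialL2NormSq H N α = 2 * Real.pi *
      ∫ ρ, Real.exp (N * (α * ρ - logPotential H ρ)) * iteratedDeriv 2 (logPotential H) ρ := by
  rw [monomialL2NormSq, integral_congr_ae (hH.ae_monomialNormSq_mul_kahlerDensity N α),
    integral_fun_norm_addHaar volume (radialDensity H N α), Complex.finrank_real_complex, ← exp_half_image,
    integral_image_eq_integral_abs_deriv_smul .univ
      (fun ρ _ => hasDerivWithinAt_exp_half ρ univ) injective_exp_half.injOn, setIntegral_univ]
  simp_rw [abs_deriv_mul_exp_half]
  simp [Measure.real, Complex.volume_ball]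
  ring

end IsToricPositiveMetric

/-! ### The two forms of the leading factor -/

theorem iteratedDeriv_two_referencePotential {x : ℝ} (hx : x ∈ Ioo (0 : ℝ) 1) :
    ContDiffAt ℝ 2 referencePotential x ∧
      iteratedDeriv 2 referencePotential x = 1 / x + 1 / (1 - x) := by
  have hx1 : 1 - x ≠ 0 := by linarith [hx.2]
  have hd : deriv referencePotential =ᶠ[nhds x] fun y => Real.log y - Real.log (1 - y) := by
    filter_upwards [isOpen_Ioo.mem_nhds hx] with y hy
    have hy0 : y ≠ 0 := hy.1.ne'
    have hy1 : 1 - y ≠ 0 := by linarith [hy.2]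
    have h2 := (hasDerivAt_id y).const_sub 1
    have h := ((hasDerivAt_id y).mul (Real.hasDerivAt_log hy0)).add (h2.mul (h2.log hy1))
    refine h.deriv.trans ?_
    simp only [id]
    field_simp
    ring
  refine ⟨(contDiffAt_id.mul (Real.contDiffAt_log.2 hx.1.ne')).add
    ((contDiffAt_const.sub contDiffAt_id).mul ((contDiffAt_const.sub contDiffAt_id).log hx1)), ?_⟩
  rw [iteratedDeriv_succ, iteratedDeriv_one, hd.deriv_eq]
  refine ((Real.hasDerivAt_log hx.1.ne').sub
    (((hasDerivAt_id x).const_sub 1).log hx1)).deriv.trans ?_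
  simp only [id]
  ring

namespace IsToricPositiveMetric

variable {H : ℂ × ℂ → ℝ}

/-- Since α G_P''(α) = 1/(1-α), the left side is α G''(α). -/
theorem one_div_add_mul_potentialDifference (hH : IsToricPositiveMetric H) {ρ : ℝ}
    (hα : deriv (logPotential H) ρ ∈ Ioo (0 : ℝ) 1) :
    1 / (1 - deriv (logPotential H) ρ) + deriv (logPotential H) ρ *
        iteratedDeriv 2 (potentialDifference H) (deriv (logPotential H) ρ) =
      deriv (logPotential H) ρ / iteratedDeriv 2 (logPotential H) ρ := by
  obtain ⟨h1, h2⟩ := hH.contDiffAt_symplecticPotential ρ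
  obtain ⟨h3, h4⟩ := iteratedDeriv_two_referencePotential hα
  have h : iteratedDeriv 2 (potentialDifference H) (deriv (logPotential H) ρ) = _ :=
    iteratedDeriv_fun_sub (contDiffAt_infty.1 h1 2) h3
  rw [h, h2, h4]
  have := (hH.iteratedDeriv_two_logPotential_pos ρ).ne'
  have := hα.1.ne'
  have : 1 - deriv (logPotential H) ρ ≠ 0 := by linarith [hα.2]
  field_simp
  ring

theorem leadingScale_eq (hH : IsToricPositiveMetric H) (N : ℕ) {ρ : ℝ}
    (hα : deriv (logPotential H) ρ ∈ Ioo (0 : ℝ) 1) :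
    leadingScale H N (deriv (logPotential H) ρ) = deriv (logPotential H) ρ *
      (√(iteratedDeriv 2 (logPotential H) ρ / deriv (logPotential H) ρ) /
        √(N * deriv (logPotential H) ρ)) := by
  rw [leadingScale, hH.one_div_add_mul_potentialDifference hα,
    ← inv_div (iteratedDeriv 2 (logPotential H) ρ), Real.sqrt_inv, div_mul_eq_div_div, div_inv_eq_mul,
    mul_div_assoc]

theorem leadingScale_eq_symplecticPotential (hH : IsToricPositiveMetric H) (N : ℕ) {ρ : ℝ}
    (hα : deriv (logPotential H) ρ ∈ Ioo (0 : ℝ) 1) :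
    leadingScale H N (deriv (logPotential H) ρ) =
      1 / (√(iteratedDeriv 2 (symplecticPotential H) (deriv (logPotential H) ρ)) * √N) := by
  have h0 := Real.sq_sqrt hα.1.le
  have h1 : √(deriv (logPotential H) ρ) ≠ 0 := (Real.sqrt_pos.2 hα.1).ne'
  rw [hH.leadingScale_eq N hα, (hH.contDiffAt_symplecticPotential ρ).2, Real.sqrt_inv,
    Real.sqrt_div (hH.iteratedDeriv_two_logPotential_pos ρ).le, Real.sqrt_mul N.cast_nonneg]
  generalize deriv (logPotential H) ρ = α at *
  rw [mul_comm _ (√N), one_div, mul_inv, inv_inv]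
  nth_rewrite 1 [← h0]
  field_simp

/-! ### The rescaled phase and the tail -/

/-- The phase of the norming integral, centred at the critical point `ρ` of its integrand. -/
noncomputable def phase (H : ℂ × ℂ → ℝ) (ρ σ : ℝ) : ℝ :=
  (logPotential H (ρ + σ) - logPotential H ρ) / deriv (logPotential H) ρ - σ

theorem contDiff_phase (hH : IsToricPositiveMetric H) (ρ : ℝ) : ContDiff ℝ ∞ (phase H ρ) := by
  have := hH.contDiff_logPotential
  exact (((this.comp (contDiff_const.add contDiff_id)).sub contDiff_const).div_const _).sub
    contDiff_id

theorem phase_zero (H : ℂ × ℂ → ℝ) (ρ : ℝ) : phase H ρ 0 = 0 := by simp [phase]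

theorem deriv_phase (hH : IsToricPositiveMetric H) (ρ : ℝ) : deriv (phase H ρ) =
    fun σ => deriv (logPotential H) (ρ + σ) / deriv (logPotential H) ρ - 1 := by
  ext σ
  exact ((((hH.hasDerivAt_logPotential (ρ + σ)).comp_const_add ρ σ).sub_const _).div_const _
    |>.sub (hasDerivAt_id σ)).deriv

theorem iteratedDeriv_phase (hH : IsToricPositiveMetric H) (ρ : ℝ) (n : ℕ) :
    iteratedDeriv (n + 2) (phase H ρ) =
      fun σ => iteratedDeriv (n + 2) (logPotential H) (ρ + σ) / deriv (logPotential H) ρ := by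
  induction n with
  | zero =>
    rw [zero_add, iteratedDeriv_succ, iteratedDeriv_one, hH.deriv_phase]
    ext σ
    exact ((((hH.hasDerivAt_deriv_logPotential (ρ + σ)).comp_const_add ρ σ).div_const _).sub_const
      _).deriv
  | succ n ih =>
    rw [show n + 1 + 2 = n + 2 + 1 by ring, iteratedDeriv_succ, ih]
    ext σ
    have h := ((hH.contDiff_logPotential.iterate_deriv (n + 2)).differentiable (by simp)
      (ρ + σ)).hasDerivAt
    rw [← iteratedDeriv_eq_iterate, ← iteratedDeriv_succ] at h
    exact ((h.comp_const_add ρ σ).div_const _).deriv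

theorem phase_le_of_one_le (hH : IsToricPositiveMetric H) {ρ σ : ℝ}
    (hα : 0 < deriv (logPotential H) ρ) (hσ : 1 ≤ σ) : phase H ρ 1 ≤ phase H ρ σ := by
  have h := hH.monotoneOn_sub ρ (show ρ + 1 ∈ Ici ρ by simp)
    (show ρ + σ ∈ Ici ρ by simp; linarith) (by linarith)
  simp only at h
  rw [phase, phase, div_sub' hα.ne', div_sub' hα.ne']
  refine div_le_div_of_nonneg_right ?_ hα.le
  linarith

theorem phase_le_of_le_neg_one (hH : IsToricPositiveMetric H) {ρ σ : ℝ}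
    (hα : 0 < deriv (logPotential H) ρ) (hσ : σ ≤ -1) : phase H ρ (-1) ≤ phase H ρ σ := by
  have h := hH.antitoneOn_sub ρ (show ρ + σ ∈ Iic ρ by simp; linarith)
    (show ρ + -1 ∈ Iic ρ by simp) (by linarith)
  simp only at h
  rw [phase, phase, div_sub' hα.ne', div_sub' hα.ne']
  refine div_le_div_of_nonneg_right ?_ hα.le
  linarith

theorem exp_mul_eq (N : ℕ) {ρ : ℝ} (hα : 0 < deriv (logPotential H) ρ) (σ : ℝ) :
    Real.exp (N * (deriv (logPotential H) ρ * (ρ + σ) - logPotential H (ρ + σ))) *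
      iteratedDeriv 2 (logPotential H) (ρ + σ) *
      Real.exp (-(N * (deriv (logPotential H) ρ * ρ - logPotential H ρ))) =
    deriv (logPotential H) ρ * (Real.exp (-(N * deriv (logPotential H) ρ * phase H ρ σ)) *
      (iteratedDeriv 2 (logPotential H) (ρ + σ) / deriv (logPotential H) ρ)) := by
  rw [mul_right_comm, ← Real.exp_add, mul_left_comm, mul_div_cancel₀ _ hα.ne', phase]
  congr 2
  field_simp
  ring

theorem integrable_exp_phase (hH : IsToricPositiveMetric H) (N : ℕ) {ρ : ℝ}
    (hα : deriv (logPotential H) ρ ∈ Ioo (0 : ℝ) 1) :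
    Integrable fun σ => Real.exp (-(N * deriv (logPotential H) ρ * phase H ρ σ)) *
      iteratedDeriv 2 (phase H ρ) σ := by
  have h := (((hH.integrable_exp_mul N hα).comp_add_left ρ).mul_const
    (Real.exp (-(N * (deriv (logPotential H) ρ * ρ - logPotential H ρ))))).const_mul
      (deriv (logPotential H) ρ)⁻¹
  refine h.congr (.of_forall fun σ => ?_)
  simp only
  rw [exp_mul_eq N hα.1, inv_mul_cancel_left₀ hα.1.ne', hH.iteratedDeriv_phase ρ 0]

theorem normingConstant_eq (hH : IsToricPositiveMetric H) (N : ℕ) {ρ : ℝ}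
    (hα : 0 < deriv (logPotential H) ρ) :
    normingConstant H N (deriv (logPotential H) ρ) = 2 * Real.pi * deriv (logPotential H) ρ *
      ∫ σ, Real.exp (-(N * deriv (logPotential H) ρ * phase H ρ σ)) *
        iteratedDeriv 2 (phase H ρ) σ := by
  rw [normingConstant, hH.monomialL2NormSq_eq, hH.symplecticPotential_deriv, hH.iteratedDeriv_phase
    ρ 0, mul_assoc, mul_assoc (2 * Real.pi), ← integral_mul_const, ← integral_const_mul,
    ← integral_add_left_eq_self _ ρ]
  simp_rw [exp_mul_eq N hα, integral_const_mul]

theorem integrable_iteratedDeriv_two_phase (hH : IsToricPositiveMetric H) (ρ : ℝ) :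
    Integrable (iteratedDeriv 2 (phase H ρ)) := by
  rw [hH.iteratedDeriv_phase ρ 0]
  exact (hH.integrable_iteratedDeriv_two_logPotential.comp_add_left ρ).div_const _

theorem integral_iteratedDeriv_two_phase (hH : IsToricPositiveMetric H) (ρ : ℝ) :
    ∫ σ, iteratedDeriv 2 (phase H ρ) σ = (deriv (logPotential H) ρ)⁻¹ := by
  rw [hH.iteratedDeriv_phase ρ 0, integral_div,
    integral_add_left_eq_self (iteratedDeriv (0 + 2) (logPotential H)) ρ, zero_add,
    hH.integral_iteratedDeriv_two_logPotential, one_div]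

/-- The part of the norming integral away from the critical point is exponentially small. -/
theorem abs_integral_sub_setIntegral_le (hH : IsToricPositiveMetric H) (N : ℕ) {ρ δ : ℝ}
    (hα : deriv (logPotential H) ρ ∈ Ioo (0 : ℝ) 1)
    (hδ : δ ≤ phase H ρ 1) (hδ' : δ ≤ phase H ρ (-1)) :
    |(∫ σ, Real.exp (-(N * deriv (logPotential H) ρ * phase H ρ σ)) *
        iteratedDeriv 2 (phase H ρ) σ) -
      ∫ σ in Icc (-1) 1, Real.exp (-(N * deriv (logPotential H) ρ * phase H ρ σ)) *
        iteratedDeriv 2 (phase H ρ) σ| ≤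
      Real.exp (-(N * deriv (logPotential H) ρ * δ)) * (deriv (logPotential H) ρ)⁻¹ := by
  have hint := hH.integrable_exp_phase N hα
  have hpos (σ : ℝ) : 0 ≤ iteratedDeriv 2 (phase H ρ) σ := by
    rw [hH.iteratedDeriv_phase ρ 0]
    exact div_nonneg (hH.iteratedDeriv_two_logPotential_pos _).le hα.1.le
  have hM : 0 ≤ N * deriv (logPotential H) ρ := mul_nonneg N.cast_nonneg hα.1.le
  -- The factor α⁻¹ in the bound is rewritten as the total mass of φ'', so it suffices to compare
  -- integrands off [-1, 1].
  rw [← integral_add_compl (measurableSet_Icc (a := (-1 : ℝ)) (b := 1)) hint, add_sub_cancel_left,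
    abs_of_nonneg (setIntegral_nonneg measurableSet_Icc.compl fun σ _ =>
      mul_nonneg (Real.exp_pos _).le (hpos σ)), ← hH.integral_iteratedDeriv_two_phase ρ,
    ← integral_const_mul]
  have hint' := (hH.integrable_iteratedDeriv_two_phase ρ).const_mul
    (Real.exp (-(N * deriv (logPotential H) ρ * δ)))
  refine (setIntegral_mono_on hint.integrableOn hint'.integrableOn measurableSet_Icc.compl
    fun σ hσ => ?_).trans (setIntegral_le_integral hint' (.of_forall fun σ =>
      mul_nonneg (Real.exp_pos _).le (hpos σ)))
  have hσδ : δ ≤ phase H ρ σ := by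
    rcases le_or_gt 1 σ with h | h
    · exact hδ.trans (hH.phase_le_of_one_le hα.1 h)
    · refine hδ'.trans (hH.phase_le_of_le_neg_one hα.1 ?_)
      by_contra! h'
      exact hσ ⟨h'.le, h.le⟩
  have := hpos σ
  gcongr

end IsToricPositiveMetric

/-! ### Uniform estimates along the path -/

namespace IsToricPath

variable {H : ℝ → ℂ × ℂ → ℝ}

/-- In the chart at infinity 1 - U'(ρ) ≤ C e^(-ρ), so U'(ρ) ≤ 2/3 forces e^ρ ≤ 3C when ρ ≥ 0. -/
theorem exists_le_of_deriv_le (hH : IsToricPath H) :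
    ∃ a, ∀ t ∈ Icc (0 : ℝ) 1, ∀ ρ, deriv (logPotential (H t)) ρ ≤ 2 / 3 → ρ ≤ a := by
  obtain ⟨C, hC0, hC⟩ := hH.swap.exists_iteratedDeriv_le one_ne_zero 0
  -- The summand 1 makes the logarithm nonnegative, so a larger ρ has -ρ ≤ 0, where the bound is
  -- available.
  refine ⟨Real.log (3 * C + 1), fun t ht ρ hρ => ?_⟩
  by_contra! h
  have hρ0 : 0 ≤ ρ := (Real.log_nonneg (by linarith)).trans h.le
  have h1 := (Real.log_lt_iff_lt_exp (by positivity)).1 h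
  have h2 := (le_abs_self _).trans (hC t ht (-ρ) (by linarith))
  rw [iteratedDeriv_one] at h2
  rw [(hH.metric t ht).deriv_logPotential_eq_swap] at hρ
  have h3 : C * Real.exp (-ρ) * Real.exp ρ = C := by
    rw [mul_assoc, ← Real.exp_add]; simp
  nlinarith [Real.exp_pos ρ]

/-- Integrate the lower bound on U'' from -∞, where both U' and e^ρ tend to 0. -/
theorem le_deriv_of_le_iteratedDeriv_two {H : ℂ × ℂ → ℝ} (hH : IsToricPositiveMetric H) {a c : ℝ}
    (hc : ∀ ρ ≤ a, c * Real.exp ρ ≤ iteratedDeriv 2 (logPotential H) ρ) {ρ : ℝ} (hρ : ρ ≤ a) :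
    c * Real.exp ρ ≤ deriv (logPotential H) ρ := by
  have hd (x : ℝ) := (hH.hasDerivAt_deriv_logPotential x).sub ((Real.hasDerivAt_exp x).const_mul c)
  have hmono : MonotoneOn (fun x => deriv (logPotential H) x - c * Real.exp x) (Iic a) :=
    monotoneOn_of_deriv_nonneg (convex_Iic a)
      (fun x _ => (hd x).continuousAt.continuousWithinAt)
      (fun x _ => (hd x).differentiableAt.differentiableWithinAt) fun x hx => by
        rw [interior_Iic] at hx
        exact le_of_le_of_eq (sub_nonneg.2 (hc x hx.le)) (hd x).deriv.symm
  have hlim := hH.tendsto_deriv_logPotential_atBot.sub (Real.tendsto_exp_atBot.const_mul c)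
  rw [mul_zero, sub_zero] at hlim
  refine sub_nonneg.1 (le_of_tendsto hlim ?_)
  filter_upwards [Filter.eventually_le_atBot ρ] with x hx
  exact hmono (hx.trans hρ) hρ hx

/-- From order 2 on, φ^(n)(σ) = U^(n)(ρ+σ)/U'(ρ). Numerator and denominator are both controlled by
e^ρ, which cancels, so nothing degenerates as ρ → -∞. -/
theorem exists_phase_bounds (hH : IsToricPath H) :
    (∃ c, 0 < c ∧ ∀ t ∈ Icc (0 : ℝ) 1, ∀ ρ, deriv (logPotential (H t)) ρ ∈ Ioc (0 : ℝ) (2 / 3) →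
      ∀ σ ∈ Icc (-1 : ℝ) 1, c ≤ iteratedDeriv 2 (IsToricPositiveMetric.phase (H t) ρ) σ) ∧
    ∀ n, ∃ B, ∀ t ∈ Icc (0 : ℝ) 1, ∀ ρ, deriv (logPotential (H t)) ρ ∈ Ioc (0 : ℝ) (2 / 3) →
      ∀ σ ∈ Icc (-1 : ℝ) 1, |iteratedDeriv n (IsToricPositiveMetric.phase (H t) ρ) σ| ≤ B := by
  obtain ⟨a, ha⟩ := hH.exists_le_of_deriv_le
  -- The bounds are evaluated at ρ + σ with σ ≤ 1, hence a + 1.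
  obtain ⟨c, hc, hcU⟩ := hH.exists_le_iteratedDeriv_two (a + 1)
  have hlow (t : ℝ) (ht : t ∈ Icc (0 : ℝ) 1) (ρ : ℝ) (hρ : ρ ≤ a + 1) :=
    le_deriv_of_le_iteratedDeriv_two (hH.metric t ht) (hcU t ht) hρ
  have hderiv (n : ℕ) (hn : n ≠ 0) : ∃ B, 0 ≤ B ∧ ∀ t ∈ Icc (0 : ℝ) 1, ∀ ρ,
      deriv (logPotential (H t)) ρ ∈ Ioc (0 : ℝ) (2 / 3) → ∀ σ ∈ Icc (-1 : ℝ) 1,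
        |iteratedDeriv n (logPotential (H t)) (ρ + σ) / deriv (logPotential (H t)) ρ| ≤ B := by
    obtain ⟨C, hC0, hC⟩ := hH.exists_iteratedDeriv_le hn (a + 1)
    refine ⟨C * Real.exp 1 / c, by positivity, fun t ht ρ hα σ hσ => ?_⟩
    have hρ := ha t ht ρ hα.2
    rw [abs_div, abs_of_pos hα.1, div_le_div_iff₀ hα.1 hc]
    calc _ ≤ C * Real.exp (ρ + 1) * c := by
          have h1 := hC t ht (ρ + σ) (by linarith [hσ.2])
          have h2 : Real.exp (ρ + σ) ≤ Real.exp (ρ + 1) := by gcongr; exact hσ.2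
          gcongr
          exact h1.trans (by gcongr)
      _ = C * Real.exp 1 * (c * Real.exp ρ) := by rw [Real.exp_add]; ring
      _ ≤ _ := by gcongr; exact hlow t ht ρ (by linarith)
  have hone : ∃ B, 0 ≤ B ∧ ∀ t ∈ Icc (0 : ℝ) 1, ∀ ρ,
      deriv (logPotential (H t)) ρ ∈ Ioc (0 : ℝ) (2 / 3) → ∀ σ ∈ Icc (-1 : ℝ) 1,
        |deriv (IsToricPositiveMetric.phase (H t) ρ) σ| ≤ B := by
    obtain ⟨B, hB0, hB⟩ := hderiv 1 one_ne_zero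
    refine ⟨B + 1, by positivity, fun t ht ρ hα σ hσ => ?_⟩
    have h := hB t ht ρ hα σ hσ
    rw [iteratedDeriv_one] at h
    rw [(hH.metric t ht).deriv_phase]
    exact (abs_sub _ _).trans (by simpa using h)
  constructor
  · obtain ⟨C, hC0, hC⟩ := hH.exists_iteratedDeriv_le one_ne_zero a
    refine ⟨c * Real.exp (-1) / (C + 1), by positivity, fun t ht ρ hα σ hσ => ?_⟩
    have hρ := ha t ht ρ hα.2
    rw [(hH.metric t ht).iteratedDeriv_phase ρ 0, div_le_div_iff₀ (by positivity) hα.1]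
    have h1 := (le_abs_self _).trans (hC t ht ρ hρ)
    rw [iteratedDeriv_one] at h1
    have h2 := hcU t ht (ρ + σ) (by linarith [hσ.2])
    have h3 : Real.exp (ρ + -1) ≤ Real.exp (ρ + σ) := by gcongr; exact hσ.1
    calc _ ≤ c * Real.exp (-1) * (C * Real.exp ρ) := by gcongr
      _ ≤ c * Real.exp (-1) * ((C + 1) * Real.exp ρ) := by gcongr; linarith
      _ = c * Real.exp (ρ + -1) * (C + 1) := by rw [Real.exp_add]; ring
      _ ≤ c * Real.exp (ρ + σ) * (C + 1) := by gcongr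
      _ ≤ _ := by gcongr
  · rintro (_ | _ | n)
    · obtain ⟨B, hB0, hB⟩ := hone
      refine ⟨B, fun t ht ρ hα σ hσ => ?_⟩
      have h := (convex_Icc (-1 : ℝ) 1).norm_image_sub_le_of_norm_deriv_le
        (fun x _ => ((hH.metric t ht).contDiff_phase ρ).differentiable (by simp) x)
        (hB t ht ρ hα) (show (0 : ℝ) ∈ Icc (-1) 1 by norm_num) hσ
      rw [IsToricPositiveMetric.phase_zero, sub_zero, sub_zero] at h
      exact h.trans (mul_le_of_le_one_right hB0 (abs_le.2 hσ))
    · obtain ⟨B, -, hB⟩ := hone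
      exact ⟨B, by simpa only [zero_add, iteratedDeriv_one] using hB⟩
    · obtain ⟨B, -, hB⟩ := hderiv (n + 2) (by simp)
      refine ⟨B, fun t ht ρ hα σ hσ => ?_⟩
      rw [(hH.metric t ht).iteratedDeriv_phase]
      exact hB t ht ρ hα σ hσ

end IsToricPath

/-! ### Absorbing the tail and assembling the expansion -/

theorem exp_neg_mul_le_div_pow {δ x : ℝ} (hδ : 0 < δ) (hx : 0 < x) (n : ℕ) :
    Real.exp (-(x * δ)) ≤ n.factorial / δ ^ n / x ^ n := by
  have h := Real.pow_div_factorial_le_exp (x * δ) (by positivity) n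
  rw [Real.exp_neg, inv_le_comm₀ (Real.exp_pos _) (by positivity)]
  refine le_of_eq_of_le ?_ h
  rw [mul_pow]
  field_simp

/-- The fourth power of the hypothesis reads N³α⁴ ≥ 1, which is αM³ ≥ 1; one more factor N ≥ 1 gives
M⁴ ≥ 1. -/
theorem one_le_mul_of_rpow_le {N : ℕ} (hN : 0 < N) {α : ℝ} (hα : (N : ℝ) ^ (-(3 / 4) : ℝ) ≤ α) :
    0 < α ∧ 1 ≤ N * α ∧ 1 ≤ α * (N * α) ^ 3 := by
  have hN' : (1 : ℝ) ≤ N := by exact_mod_cast hN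
  have hN0 : (0 : ℝ) < N := by positivity
  have h0 : 0 < (N : ℝ) ^ (-(3 / 4) : ℝ) := by positivity
  have hα0 := h0.trans_le hα
  have h4 : 1 ≤ N ^ 3 * α ^ 4 := by
    have h := pow_le_pow_left₀ h0.le hα 4
    rw [← Real.rpow_natCast, ← Real.rpow_mul hN0.le] at h
    calc (1 : ℝ) = N ^ 3 * (N : ℝ) ^ (-(3 / 4) * (4 : ℕ) : ℝ) := by
          rw [← Real.rpow_natCast, ← Real.rpow_add hN0]; norm_num
      _ ≤ _ := by gcongr
  refine ⟨hα0, ?_, by linarith [show α * (N * α) ^ 3 = N ^ 3 * α ^ 4 by ring]⟩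
  by_contra! h
  have h1 : (N * α) ^ 4 < 1 := pow_lt_one₀ (by positivity) h (by norm_num)
  have h2 : (N : ℝ) * 1 ≤ N * (N ^ 3 * α ^ 4) := by gcongr
  linarith [show (N : ℝ) * (N ^ 3 * α ^ 4) = (N * α) ^ 4 by ring]

theorem two_mul_pi_rpow : (2 * Real.pi) ^ (3 / 2 : ℝ) = 2 * Real.pi * √(2 * Real.pi) := by
  rw [Real.sqrt_eq_rpow, show (3 / 2 : ℝ) = 1 + 1 / 2 by norm_num,
    Real.rpow_add (by positivity), Real.rpow_one]

namespace IsToricPath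

variable {H : ℝ → ℂ × ℂ → ℝ}

/-- The parameters are pairs (t, ρ), with ρ the critical point and α = U'(ρ). N enters only through
M, so the coefficients do not depend on it. -/
theorem exists_normingConstant_expansion (hH : IsToricPath H) :
    ∃ A : ℕ → {p : ℝ × ℝ // p.1 ∈ Icc (0 : ℝ) 1 ∧
        deriv (logPotential (H p.1)) p.2 ∈ Ioc (0 : ℝ) (2 / 3)} → ℝ,
      (∀ k, ∃ B, ∀ p, |A k p| ≤ B) ∧ (∀ p, A 0 p = 1) ∧
      ∀ R : ℕ, ∃ C, 0 < C ∧ ∀ p (N : ℕ) (α : ℝ), deriv (logPotential (H p.1.1)) p.1.2 = α →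
        1 ≤ N * α → 1 ≤ α * (N * α) ^ 3 →
        |normingConstant (H p.1.1) N α - (2 * Real.pi) ^ (3 / 2 : ℝ) *
          leadingScale (H p.1.1) N α * ∑ k ∈ Finset.range (R + 1), A k p / (N * α) ^ k| ≤
        C * leadingScale (H p.1.1) N α / (N * α) ^ (R + 1) := by
  obtain ⟨⟨c, hc, hcφ⟩, hB⟩ := hH.exists_phase_bounds
  have hm (p : {p : ℝ × ℝ // p.1 ∈ Icc (0 : ℝ) 1 ∧
      deriv (logPotential (H p.1)) p.2 ∈ Ioc (0 : ℝ) (2 / 3)}) := hH.metric p.1.1 p.2.1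
  obtain ⟨A, hAB, hA0, hA⟩ := exists_uniform_laplace_expansion
    (φ := fun p : {p : ℝ × ℝ // p.1 ∈ Icc (0 : ℝ) 1 ∧
      deriv (logPotential (H p.1)) p.2 ∈ Ioc (0 : ℝ) (2 / 3)} =>
        IsToricPositiveMetric.phase (H p.1.1) p.1.2)
    (fun p => (hm p).contDiff_phase _) (fun p => IsToricPositiveMetric.phase_zero _ _)
    (fun p => by rw [(hm p).deriv_phase]; simp [p.2.2.1.ne'])
    (fun n => (hB n).imp fun B h p => h p.1.1 p.2.1 p.1.2 p.2.2) hc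
    (fun p => hcφ p.1.1 p.2.1 p.1.2 p.2.2)
  refine ⟨A, hAB, hA0, fun R => ?_⟩
  obtain ⟨C, hC⟩ := hA R
  -- The exponent is R + 5 = (R + 1) + 3 + 1: the target order, three powers to produce α from αM³ ≥
  -- 1, and one to pass from 1/M to 1/√M.
  set K : ℝ := (R + 5).factorial / (c / 2) ^ (R + 5)
  have hK : 0 < K := by positivity
  refine ⟨2 * Real.pi * (|C| + K / √c), by positivity, fun p N α hpα hM hM3 => ?_⟩
  have hαm := p.2.2
  have hα1 : deriv (logPotential (H p.1.1)) p.1.2 ∈ Ioo (0 : ℝ) 1 := ⟨hαm.1, by linarith [hαm.2]⟩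
  have hlow := hcφ p.1.1 p.2.1 p.1.2 hαm
  have htaylor (x : ℝ) (hx : x ∈ Icc (-1 : ℝ) 1) (hx0 : x ≠ 0) (hx2 : x ^ 2 = 1) :
      c / 2 ≤ IsToricPositiveMetric.phase (H p.1.1) p.1.2 x := by
    obtain ⟨y, hy, h⟩ := exists_taylor_remainder ((hm p).contDiff_phase p.1.2) hx0 2
    have hy1 : y ∈ Icc (-1 : ℝ) 1 :=
      (uIcc_subset_Icc (by norm_num) hx : uIcc 0 x ⊆ Icc (-1) 1) hy
    have hd : deriv (IsToricPositiveMetric.phase (H p.1.1) p.1.2) 0 = 0 := by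
      rw [(hm p).deriv_phase]; simp [hαm.1.ne']
    simp [Finset.sum_range_succ, IsToricPositiveMetric.phase_zero, hd, iteratedDeriv_one,
      hx2] at h
    rw [h]
    gcongr
    exact hlow y hy1
  have htail := (hm p).abs_integral_sub_setIntegral_le N hα1
    (htaylor 1 (by norm_num) (by norm_num) (by norm_num))
    (htaylor (-1) (by norm_num) (by norm_num) (by norm_num))
  have hmain := hC p (N * α) (by linarith)
  have hQ := (hm p).normingConstant_eq N hα1.1
  have hL := (hm p).leadingScale_eq N hα1
  have hb := hlow 0 (by norm_num)
  have hφ0 : iteratedDeriv 2 (logPotential (H p.1.1)) p.1.2 /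
      deriv (logPotential (H p.1.1)) p.1.2 =
      iteratedDeriv 2 (IsToricPositiveMetric.phase (H p.1.1) p.1.2) 0 := by
    rw [(hm p).iteratedDeriv_phase _ 0]; simp
  rw [hφ0] at hL
  rw [hpα] at hα1 hQ htail hL
  rw [hQ, hL, two_mul_pi_rpow]
  set b := iteratedDeriv 2 (IsToricPositiveMetric.phase (H p.1.1) p.1.2) 0
  set M := (N : ℝ) * α
  set S := ∑ k ∈ Finset.range (R + 1), A k p / M ^ k
  set I := ∫ σ, Real.exp (-(M * IsToricPositiveMetric.phase (H p.1.1) p.1.2 σ)) *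
    iteratedDeriv 2 (IsToricPositiveMetric.phase (H p.1.1) p.1.2) σ
  set J := ∫ σ in Icc (-1) 1, Real.exp (-(M * IsToricPositiveMetric.phase (H p.1.1) p.1.2 σ)) *
    iteratedDeriv 2 (IsToricPositiveMetric.phase (H p.1.1) p.1.2) σ
  have hM0 : 0 < M := by linarith
  have hα0 := hα1.1
  have hsM : √M ≤ M := Real.sqrt_le_iff.2 ⟨hM0.le, by nlinarith⟩
  have hexp : Real.exp (-(M * (c / 2))) ≤ K / √c * (α * (√b / √M) / M ^ (R + 1)) := by
    calc _ ≤ K / M ^ (R + 5) := exp_neg_mul_le_div_pow (by positivity) hM0 (R + 5)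
      _ = K / √c * (1 * (√c / M) / M ^ (R + 1)) * (1 / M ^ 3) := by
        rw [show R + 5 = R + 1 + 3 + 1 by ring, pow_succ, pow_add _ _ 3]
        field_simp
      _ ≤ K / √c * (1 * (√b / √M) / M ^ (R + 1)) * α := by
        gcongr
        rw [div_le_iff₀ (by positivity)]
        exact hM3
      _ = _ := by ring
  have hsplit : 2 * Real.pi * α * I - 2 * Real.pi * √(2 * Real.pi) * (α * (√b / √M)) * S =
      2 * Real.pi * α * (I - J) + 2 * Real.pi * α * (J - √(2 * Real.pi) * (√b / √M) * S) := by
    ring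
  rw [hsplit]
  calc _ ≤ 2 * Real.pi * α * |I - J| + 2 * Real.pi * α * |J - √(2 * Real.pi) * (√b / √M) * S| := by
        refine (abs_add_le _ _).trans_eq ?_
        rw [abs_mul, abs_mul (2 * Real.pi * α), abs_of_pos (by positivity : 0 < 2 * Real.pi * α)]
    _ ≤ 2 * Real.pi * α * (Real.exp (-(M * (c / 2))) * α⁻¹) +
        2 * Real.pi * α * (|C| * (√b / √M / M ^ (R + 1))) := by
        gcongr
        exact hmain.trans (by gcongr; exact le_abs_self C)
    _ = 2 * Real.pi * Real.exp (-(M * (c / 2))) +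
        2 * Real.pi * |C| * (α * (√b / √M) / M ^ (R + 1)) := by
        field_simp
    _ ≤ 2 * Real.pi * (K / √c * (α * (√b / √M) / M ^ (R + 1))) +
        2 * Real.pi * |C| * (α * (√b / √M) / M ^ (R + 1)) := by
        gcongr
    _ = _ := by ring

end IsToricPath

theorem proposition3p1 (H : ℝ → ℂ × ℂ → ℝ) (hH : IsToricGeodesic H) :
    -- the quantities in the expansion are well defined, and the two forms of its leading factor
    -- agree
    (∀ t ∈ Icc (0 : ℝ) 1, ∀ N : ℕ, 0 < N →
      ∀ α ∈ Icc ((N : ℝ) ^ (-(3 / 4) : ℝ)) (2 / 3),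
        Integrable (fun z : ℂ => monomialNormSq (H t) N α z * kahlerDensity (H t) z) ∧
        ContDiffAt ℝ ∞ (symplecticPotential (H t)) α ∧
        0 < iteratedDeriv 2 (symplecticPotential (H t)) α ∧
        0 < 1 / (1 - α) + α * iteratedDeriv 2 (potentialDifference (H t)) α ∧
        leadingScale (H t) N α =
          1 / (Real.sqrt (iteratedDeriv 2 (symplecticPotential (H t)) α) * Real.sqrt N)) ∧
    -- the expansion
    ∃ A : ℝ → ℕ → ℝ → ℝ,
      (∀ k : ℕ, ∃ B : ℝ, ∀ t ∈ Icc (0 : ℝ) 1, ∀ α ∈ Ioc (0 : ℝ) (2 / 3), |A t k α| ≤ B) ∧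
      (∀ t ∈ Icc (0 : ℝ) 1, ∀ α ∈ Ioc (0 : ℝ) (2 / 3), A t 0 α = 1) ∧
      ∀ R : ℕ, ∃ C : ℝ, 0 < C ∧
        ∀ t ∈ Icc (0 : ℝ) 1, ∀ N : ℕ, 0 < N →
          ∀ α ∈ Icc ((N : ℝ) ^ (-(3 / 4) : ℝ)) (2 / 3),
            |normingConstant (H t) N α -
                (2 * Real.pi) ^ (3 / 2 : ℝ) * leadingScale (H t) N α *
                  ∑ k ∈ Finset.range (R + 1), A t k α / ((N : ℝ) * α) ^ k| ≤
              C * leadingScale (H t) N α / ((N : ℝ) * α) ^ (R + 1) := by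
  have hcrit (t α : ℝ) (h : t ∈ Icc (0 : ℝ) 1 ∧ α ∈ Ioc (0 : ℝ) (2 / 3)) :
      ∃ ρ, deriv (logPotential (H t)) ρ = α :=
    (hH.metric t h.1).exists_deriv_logPotential_eq ⟨h.2.1, by linarith [h.2.2]⟩
  refine ⟨fun t ht N hN α hα => ?_, ?_⟩
  · have hm := hH.metric t ht
    have hα0 := (one_le_mul_of_rpow_le hN hα.1).1
    have hα1 : α ∈ Ioo (0 : ℝ) 1 := ⟨hα0, by linarith [hα.2]⟩
    refine ⟨hm.integrable_monomialNormSq_mul N hα1, ?_⟩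
    obtain ⟨ρ, rfl⟩ := hcrit t α ⟨ht, hα0, hα.2⟩
    have hU := hm.iteratedDeriv_two_logPotential_pos ρ
    obtain ⟨h1, h2⟩ := hm.contDiffAt_symplecticPotential ρ
    refine ⟨h1, ?_, ?_, hm.leadingScale_eq_symplecticPotential N hα1⟩
    · rw [h2]; exact inv_pos.2 hU
    · rw [hm.one_div_add_mul_potentialDifference hα1]; exact div_pos hα0 hU
  · classical
    obtain ⟨A, hB, hA0, hA⟩ := hH.isToricPath.exists_normingConstant_expansion
    choose ρ hρ using hcrit
    -- The coefficient at α is the one at a chosen critical point over α; the value 0 outside the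
    -- parameter range is never used.
    refine ⟨fun t k α => if h : t ∈ Icc (0 : ℝ) 1 ∧ α ∈ Ioc (0 : ℝ) (2 / 3) then
      A k ⟨(t, ρ t α h), h.1, by rw [hρ]; exact h.2⟩ else 0, fun k => ?_, fun t ht α hα => ?_,
      fun R => ?_⟩
    · obtain ⟨B, hB⟩ := hB k
      refine ⟨B, fun t ht α hα => ?_⟩
      have hmem : t ∈ Icc (0 : ℝ) 1 ∧ α ∈ Ioc (0 : ℝ) (2 / 3) := ⟨ht, hα⟩
      simp only [dif_pos hmem]
      exact hB _
    · have hmem : t ∈ Icc (0 : ℝ) 1 ∧ α ∈ Ioc (0 : ℝ) (2 / 3) := ⟨ht, hα⟩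
      simp only [dif_pos hmem]
      exact hA0 _
    · obtain ⟨C, hC, h⟩ := hA R
      refine ⟨C, hC, fun t ht N hN α hα => ?_⟩
      obtain ⟨hα0, hM, hM3⟩ := one_le_mul_of_rpow_le hN hα.1
      have hmem : t ∈ Icc (0 : ℝ) 1 ∧ α ∈ Ioc (0 : ℝ) (2 / 3) := ⟨ht, hα0, hα.2⟩
      simp only [dif_pos hmem]
      exact h ⟨(t, ρ t α hmem), hmem.1, by rw [hρ]; exact hmem.2⟩ N α (hρ t α hmem) hM hM3
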